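/- Throughout, $\mathrm{C}^*$-algebras are complex and unital and $*$-homomorphisms preserve the unit. A \emph{rational polynomial} is a $*$-polynomial in finitely many noncommuting variables with coefficients in $\mathbb{Q}(i)$ (constant terms, i.e. multiples of the unit, are allowed). A \emph{presentation} $C^\dagger$ of a $\mathrm{C}^*$-algebra $C$ is $C$ together with a sequence (or finite tuple) of \emph{special points} that generates $C$ as a unital $\mathrm{C}^*$-algebra; its \emph{rational points} are the values of rational polynomials at special points. $C^\dagger$ is \emph{computable} if there is an algorithm which, given (a code of) a rational point $p$ and $n\in\mathbb{N}$, returns a rational number $r$ with $\bigl|\|p\|-r\bigr|<2^{-n}$. For a nonprincipal ultrafilter $\mathcal U$ on $\mathbb{N}$, the ultrapower $B^{\mathcal U}$ is the quotient of the algebra $\ell^\infty(\mathbb{N},B)$ of norm-bounded sequences by the ideal of those $(b_m)$ with $\lim_{\mathcal U}\|b_m\|=0$. A $\mathrm{C}^*$-algebra $B$ is \emph{locally universal} if every nonzero separable $\mathrm{C}^*$-algebra embeds into $B^{\mathcal U}$ for some nonprincipal ultrafilter $\mathcal U$ on $\mathbb{N}$. Let $\bar x=(x_1,\dots,x_k)$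 be finitely many generators and let $\mathcal R$ be a finite set of relations consisting of $\|p_i(\bar x)\|\le a_i$ ($i=1,\dots,\ell$), with $p_i$ a rational polynomial and $a_i$ a nonnegative dyadic rational (the relation $p_i(\bar x)=0$ being the case $a_i=0$), and of one bound $\|x_j\|\le C_j$, with $C_j$ a nonnegative dyadic rational, for each $j$. A representation of $\mathcal R$ is a tuple in a $\mathrm{C}^*$-algebra that satisfies all these relations, and $A=C^*\langle \bar x\mid\mathcal R\rangle$ is the $\mathrm{C}^*$-algebra with a representation $\bar x$ such that for every representation $\bar z$ of $\mathcal R$ in a $\mathrm{C}^*$-algebra $D$ there is a unique $*$-homomorphism $\varphi:A\to D$ with $\varphi(x_j)=z_j$ for all $j$. The presentation $A^\dagger=(A,\bar x)$ is then called \emph{finitely c.e.} It is \emph{computably weakly stable} (with respect to $\mathcal R$) if there is an algorithm which, given $n\in\mathbb{N}$, returns $m\in\mathbb{N}$ such that for every $\mathrm{C}^*$-algebra $D$ and every tuple $\bar z$ in $D$ with $\|p_i(\bar z)\|\le a_i+2^{-m}$ for all $i$ and $\|z_j\|\le C_j+2^{-m}$ for all $j$, there is a $*$-homomorphism $\varphi:A\to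 D$ with $\|\varphi(x_j)-z_j\|<2^{-n}$ for all $j$. \textbf{Theorem.} If there exists a locally universal $\mathrm{C}^*$-algebra $B$ with a computable presentation $B^\dagger$, then every computably weakly stable finitely c.e. presentation $A^\dagger$ of a $\mathrm{C}^*$-algebra $A$ is computable. -/

import Mathlib

open Filter Topology
open scoped BoundedContinuousFunction

universe u v

/-! ### Ultrapowers of C*-algebras

Unital complex C*-algebras are Mathlib's `CStarAlgebra`; unital *-homomorphisms are `→⋆ₐ[ℂ]`.
`ℕ →ᵇ B` (with `ℕ` discrete) is the algebra `ℓ^∞(ℕ, B)` of norm-bounded sequences in `B`. -/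

/-- The algebra `ℓ^∞(ℕ, B)` of norm-bounded sequences, to be equipped with the seminorm
`‖f‖ = lim_U ‖f m‖`. -/
def BoundedSeq (_U : Ultrafilter ℕ) (B : Type u) [CStarAlgebra B] : Type u := ℕ →ᵇ B

namespace BoundedSeq

variable {U : Ultrafilter ℕ} {B : Type u} [CStarAlgebra B]

noncomputable instance : Ring (BoundedSeq U B) := inferInstanceAs (Ring (ℕ →ᵇ B))
noncomputable instance : StarRing (BoundedSeq U B) := inferInstanceAs (StarRing (ℕ →ᵇ B))
noncomputable instance : Algebra ℂ (BoundedSeq U B) := inferInstanceAs (Algebra ℂ (ℕ →ᵇ B))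
instance : StarModule ℂ (BoundedSeq U B) := inferInstanceAs (StarModule ℂ (ℕ →ᵇ B))

/-- A bounded sequence, seen as an element of `BoundedSeq U B`. -/
def of (U : Ultrafilter ℕ) (f : ℕ →ᵇ B) : BoundedSeq U B := f

/-- The `m`-th term of a bounded sequence. -/
def term (f : BoundedSeq U B) (m : ℕ) : B := (show ℕ →ᵇ B from f) m

/-- The limit of `‖f m‖` along the ultrafilter `U`. -/
noncomputable def limNorm (f : BoundedSeq U B) : ℝ :=
  limUnder (U : Filter ℕ) fun m => ‖f.term m‖

theorem tendsto_limNorm (f : BoundedSeq U B) :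
    Tendsto (fun m => ‖f.term m‖) U (𝓝 f.limNorm) := by
  apply tendsto_nhds_limUnder
  have hc : IsCompact (Set.Icc (0 : ℝ) ‖(show ℕ →ᵇ B from f)‖) := isCompact_Icc
  obtain ⟨x, -, hx⟩ := hc.ultrafilter_le_nhds (U.map fun m => ‖f.term m‖) (by
    rw [le_principal_iff]
    exact Filter.mem_map.2 (Filter.univ_mem'
      fun m => ⟨norm_nonneg _, BoundedContinuousFunction.norm_coe_le_norm _ m⟩))
  exact ⟨x, hx⟩

theorem limNorm_eq {f : BoundedSeq U B} {a : ℝ}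
    (h : Tendsto (fun m => ‖f.term m‖) U (𝓝 a)) : f.limNorm = a :=
  tendsto_nhds_unique f.tendsto_limNorm h

theorem limNorm_le {f : BoundedSeq U B} {a : ℝ} (h : ∀ m, ‖f.term m‖ ≤ a) : f.limNorm ≤ a :=
  le_of_tendsto f.tendsto_limNorm (Eventually.of_forall h)

noncomputable instance : SeminormedRing (BoundedSeq U B) :=
  RingSeminorm.toSeminormedRing
    { toFun := limNorm
      map_zero' := limNorm_eq (by
        have h : ∀ m, (0 : BoundedSeq U B).term m = 0 := fun _ => rfl
        simp [h])
      add_le' := fun f g => le_of_tendsto_of_tendsto' (f + g).tendsto_limNorm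
        (f.tendsto_limNorm.add g.tendsto_limNorm) fun m => norm_add_le (f.term m) (g.term m)
      neg' := fun f => limNorm_eq (by
        have h : ∀ m, (-f).term m = -(f.term m) := fun _ => rfl
        simpa [h] using f.tendsto_limNorm)
      mul_le' := fun f g => le_of_tendsto_of_tendsto' (f * g).tendsto_limNorm
        (f.tendsto_limNorm.mul g.tendsto_limNorm) fun m => norm_mul_le (f.term m) (g.term m) }

theorem norm_def (f : BoundedSeq U B) : ‖f‖ = f.limNorm := rfl

noncomputable instance : NormedAlgebra ℂ (BoundedSeq U B) where
  norm_smul_le c f := by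
    refine le_of_eq (limNorm_eq ?_)
    have h : ∀ m, (c • f).term m = c • f.term m := fun _ => rfl
    simpa [h, norm_smul, norm_def] using f.tendsto_limNorm.const_mul ‖c‖

instance : NormedStarGroup (BoundedSeq U B) where
  norm_star_le f := by
    refine le_of_eq (limNorm_eq ?_)
    have h : ∀ m, (star f).term m = star (f.term m) := fun _ => rfl
    simpa [h, norm_def] using f.tendsto_limNorm

theorem norm_star_mul_self (f : BoundedSeq U B) : ‖star f * f‖ = ‖f‖ * ‖f‖ := by
  refine limNorm_eq ?_
  have h : ∀ m, (star f * f).term m = star (f.term m) * f.term m := fun _ => rfl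
  simpa [h, CStarRing.norm_star_mul_self, norm_def] using f.tendsto_limNorm.mul f.tendsto_limNorm

theorem norm_of_le (f : ℕ →ᵇ B) : ‖of U f‖ ≤ ‖f‖ :=
  limNorm_le fun m => BoundedContinuousFunction.norm_coe_le_norm f m

/-- Every bounded sequence is equivalent to one whose supremum norm is almost its seminorm. -/
theorem exists_lift (f : BoundedSeq U B) {ε : ℝ} (hε : 0 < ε) :
    ∃ g : ℕ →ᵇ B, ‖g‖ ≤ ‖f‖ + ε ∧ ‖f - of U g‖ = 0 := by
  classical
  have h0 : 0 ≤ ‖f‖ + ε := by positivity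
  let g : ℕ →ᵇ B := BoundedContinuousFunction.ofNormedAddCommGroup
    (fun m => if ‖f.term m‖ ≤ ‖f‖ + ε then f.term m else 0) continuous_of_discreteTopology
    (‖f‖ + ε) (fun m => by
      split_ifs with h
      · exact h
      · simpa using h0)
  refine ⟨g, BoundedContinuousFunction.norm_ofNormedAddCommGroup_le _ h0 _, ?_⟩
  refine limNorm_eq (tendsto_const_nhds.congr' ?_)
  have hlt : ∀ᶠ m in (U : Filter ℕ), ‖f.term m‖ < ‖f‖ + ε :=
    f.tendsto_limNorm.eventually_lt_const (by rw [norm_def]; linarith)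
  filter_upwards [hlt] with m hm
  have h : (f - of U g).term m =
      f.term m - (if ‖f.term m‖ ≤ ‖f‖ + ε then f.term m else 0) := rfl
  rw [h, if_pos hm.le, sub_self, norm_zero]

end BoundedSeq

/-- The ultrapower `B^U`: the quotient of `ℓ^∞(ℕ, B)` by the ideal of all sequences with
`lim_U ‖f m‖ = 0`, i.e. the separation quotient of the seminorm `lim_U ‖f m‖`. -/
abbrev CStarUltrapower (U : Ultrafilter ℕ) (B : Type u) [CStarAlgebra B] : Type u :=
  SeparationQuotient (BoundedSeq U B)

namespace CStarUltrapower

variable {U : Ultrafilter ℕ} {B : Type u} [CStarAlgebra B]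

/-- Two bounded sequences have the same coset iff `lim_U ‖f m - g m‖ = 0`. -/
theorem mk_eq_mk_iff (f g : BoundedSeq U B) :
    (SeparationQuotient.mk f : CStarUltrapower U B) = SeparationQuotient.mk g ↔
      Tendsto (fun m => ‖f.term m - g.term m‖) U (𝓝 0) := by
  rw [SeparationQuotient.mk_eq_mk, Metric.inseparable_iff, dist_eq_norm]
  constructor
  · intro h
    have := (f - g).tendsto_limNorm
    rwa [← BoundedSeq.norm_def, h] at this
  · intro h
    exact BoundedSeq.limNorm_eq h

instance : CompleteSpace (CStarUltrapower U B) := by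
  apply NormedAddCommGroup.completeSpace_of_summable_imp_tendsto
  intro w hw
  have hlift : ∀ n : ℕ, ∃ g : ℕ →ᵇ B, ‖g‖ ≤ ‖w n‖ + (1 / 2 : ℝ) ^ n ∧
      (SeparationQuotient.mk (BoundedSeq.of U g) : CStarUltrapower U B) = w n := by
    intro n
    obtain ⟨f, hf⟩ := SeparationQuotient.surjective_mk (w n)
    obtain ⟨g, hg1, hg2⟩ := f.exists_lift (ε := (1 / 2 : ℝ) ^ n) (by positivity)
    rw [← hf]
    refine ⟨g, hg1, (SeparationQuotient.mk_eq_mk.2 ?_).symm⟩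
    rw [Metric.inseparable_iff, dist_eq_norm, hg2]
  choose g hg1 hg2 using hlift
  have hgs : Summable g :=
    Summable.of_norm_bounded (hw.add summable_geometric_two) hg1
  let F : (ℕ →ᵇ B) →+ CStarUltrapower U B :=
    { toFun := fun h => SeparationQuotient.mk (BoundedSeq.of U h)
      map_zero' := rfl
      map_add' := fun _ _ => rfl }
  have hF : Continuous F := AddMonoidHomClass.continuous_of_bound F 1 fun h => by
    rw [one_mul]
    exact BoundedSeq.norm_of_le (U := U) h
  refine ⟨F (∑' n, g n), ?_⟩
  have hsum := (hF.tendsto _).comp hgs.hasSum.tendsto_sum_nat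
  refine hsum.congr fun n => ?_
  simp only [Function.comp_apply, map_sum]
  exact Finset.sum_congr rfl fun i _ => hg2 i

noncomputable instance : StarRing (CStarUltrapower U B) where
  star := Quotient.map star fun f g h => by
    have h' : Inseparable f g := h
    exact h'.map continuous_star
  star_involutive := by
    rintro ⟨f⟩
    exact congrArg SeparationQuotient.mk (star_star f)
  star_mul := by
    rintro ⟨f⟩ ⟨g⟩
    exact congrArg SeparationQuotient.mk (star_mul f g)
  star_add := by
    rintro ⟨f⟩ ⟨g⟩
    exact congrArg SeparationQuotient.mk (star_add f g)

theorem star_mk (f : BoundedSeq U B) :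
    star (SeparationQuotient.mk f : CStarUltrapower U B) = SeparationQuotient.mk (star f) := rfl

instance : StarModule ℂ (CStarUltrapower U B) where
  star_smul c := by
    rintro ⟨f⟩
    exact congrArg SeparationQuotient.mk (star_smul c f)

instance : CStarRing (CStarUltrapower U B) where
  norm_mul_self_le := by
    rintro ⟨f⟩
    exact (BoundedSeq.norm_star_mul_self f).ge

noncomputable instance : CStarAlgebra (CStarUltrapower U B) where

end CStarUltrapower

/-- `B` is locally universal: every (nonzero, separable, unital) C*-algebra embeds into an
ultrapower of `B` along a nonprincipal ultrafilter on `ℕ`. -/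
def IsLocallyUniversal (B : Type u) [CStarAlgebra B] : Prop :=
  ∀ (C : Type u) [CStarAlgebra C] [Nontrivial C] [TopologicalSpace.SeparableSpace C],
    ∃ U : Ultrafilter ℕ, (∀ n : ℕ, U ≠ pure n) ∧
      ∃ φ : C →⋆ₐ[ℂ] CStarUltrapower U B, Function.Injective φ

/-! ### Rational *-polynomials -/

/-- Codes for rational numbers: `(a, b, c)` stands for `(a - b) / (c + 1)`. -/
abbrev RatCode : Type := ℕ × ℕ × ℕ

/-- The rational number with a given code. -/
def RatCode.val (q : RatCode) : ℚ := ((q.1 : ℚ) - (q.2.1 : ℚ)) / ((q.2.2 : ℚ) + 1)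

/-- Codes for elements of `ℚ(i)`: real and imaginary part. -/
abbrev GaussCode : Type := RatCode × RatCode

/-- The complex number with a given code. -/
noncomputable def GaussCode.val (c : GaussCode) : ℂ :=
  ((RatCode.val c.1 : ℚ) : ℂ) + ((RatCode.val c.2 : ℚ) : ℂ) * Complex.I

/-- Rational *-polynomials in noncommuting variables indexed by `ι`, as finite lists of monomials.
A monomial is a coefficient in `ℚ(i)` with a word; the letter `(j, false)` stands for the variable
`x j` and `(j, true)` for its adjoint. The empty word stands for the unit. -/
abbrev RatPoly (ι : Type) : Type := List (GaussCode × List (ι × Bool))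

/-- The value of a letter at a tuple `z`. -/
def evalLetter {ι : Type} {C : Type v} [CStarAlgebra C] (z : ι → C) (l : ι × Bool) : C :=
  if l.2 then star (z l.1) else z l.1

/-- The value `p(z)` of a rational *-polynomial at a tuple `z` in a C*-algebra. -/
noncomputable def RatPoly.eval {ι : Type} {C : Type v} [CStarAlgebra C] (p : RatPoly ι)
    (z : ι → C) : C :=
  (p.map fun t => GaussCode.val t.1 • (t.2.map (evalLetter z)).prod).sum

/-! ### Presentations -/

/-- A presentation of a unital C*-algebra `A` with special points indexed by `ι` (usually `ℕ`, or
`Fin k` for a finite tuple): a family that generates `A` as a unital C*-algebra. -/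
structure CStarPresentation (ι : Type) (A : Type u) [CStarAlgebra A] where
  /-- the special points -/
  point : ι → A
  /-- the special points generate `A` -/
  generates : (StarAlgebra.adjoin ℂ (Set.range point)).topologicalClosure = ⊤

/-- A presentation is computable if some algorithm, given (the code of) a rational point `p` and
`n : ℕ`, returns a rational number within `2⁻ⁿ` of `‖p‖`. -/
def CStarPresentation.IsComputable {ι : Type} [Primcodable ι] {A : Type u} [CStarAlgebra A]
    (P : CStarPresentation ι A) : Prop :=
  ∃ f : RatPoly ι → ℕ → RatCode, Computable₂ f ∧
    ∀ (p : RatPoly ι) (n : ℕ),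
      |‖p.eval P.point‖ - ((RatCode.val (f p n) : ℚ) : ℝ)| < (2 : ℝ)⁻¹ ^ n

/-- Codes for nonnegative dyadic rationals: `(a, b)` stands for `a / 2 ^ b`. -/
abbrev DyadicCode : Type := ℕ × ℕ

/-- The real number with a given dyadic code. -/
noncomputable def DyadicCode.val (d : DyadicCode) : ℝ := (d.1 : ℝ) / 2 ^ d.2

/-- A finite set of rational relations for the generators `x j`, `j : Fin k`: finitely many
relations `‖p(x)‖ ≤ a`, together with a bound `‖x j‖ ≤ C j` for each generator. The relation
`p(x) = 0` is `‖p(x)‖ ≤ 0`. -/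
structure FiniteRationalRelations (k : ℕ) where
  /-- the relations `‖p(x)‖ ≤ a` -/
  rels : List (RatPoly (Fin k) × DyadicCode)
  /-- the bounds `‖x j‖ ≤ C j` -/
  bound : Fin k → DyadicCode

namespace FiniteRationalRelations

variable {k : ℕ} (R : FiniteRationalRelations k)

/-- `z` satisfies all relations up to the error `δ`. -/
def SatisfiesUpTo {C : Type v} [CStarAlgebra C] (z : Fin k → C) (δ : ℝ) : Prop :=
  (∀ r ∈ R.rels, ‖r.1.eval z‖ ≤ DyadicCode.val r.2 + δ) ∧
    ∀ j, ‖z j‖ ≤ DyadicCode.val (R.bound j) + δ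

/-- `z` is a representation of the relations. -/
def IsRepresentation {C : Type v} [CStarAlgebra C] (z : Fin k → C) : Prop :=
  (∀ r ∈ R.rels, ‖r.1.eval z‖ ≤ DyadicCode.val r.2) ∧
    ∀ j, ‖z j‖ ≤ DyadicCode.val (R.bound j)

/-- `A`, with the tuple `x`, is the universal (unital) C*-algebra `C*⟨x | R⟩`. -/
def IsUniversal (A : Type u) [CStarAlgebra A] (x : Fin k → A) : Prop :=
  R.IsRepresentation x ∧
    ∀ (C : Type u) [CStarAlgebra C] (z : Fin k → C), R.IsRepresentation z →
      ∃! φ : A →⋆ₐ[ℂ] C, ∀ j, φ (x j) = z j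

end FiniteRationalRelations

namespace CStarPresentation

variable {k : ℕ} {A : Type u} [CStarAlgebra A]

/-- `P` is the standard presentation of `A = C*⟨x | R⟩`; such a `P` is a finitely c.e. presentation
of `A`. -/
def IsStandard (P : CStarPresentation (Fin k) A) (R : FiniteRationalRelations k) : Prop :=
  R.IsUniversal A P.point

/-- The finitely c.e. presentation `P` of `A = C*⟨x | R⟩` is computably weakly stable: there is an
algorithm `n ↦ m n` such that every tuple `z` in a C*-algebra which satisfies the relations up to
`2 ^ (-m n)` is within `2 ^ (-n)` of the image of `x` under a *-homomorphism defined on `A`. -/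
def IsComputablyWeaklyStable (P : CStarPresentation (Fin k) A) (R : FiniteRationalRelations k) :
    Prop :=
  ∃ m : ℕ → ℕ, Computable m ∧
    ∀ (n : ℕ) (C : Type u) [CStarAlgebra C] (z : Fin k → C),
      R.SatisfiesUpTo z ((2 : ℝ)⁻¹ ^ m n) →
        ∃ φ : A →⋆ₐ[ℂ] C, ∀ j, ‖φ (P.point j) - z j‖ < (2 : ℝ)⁻¹ ^ n

end CStarPresentation

/-! ### Arithmetic of codes -/

/-! The norm of `p(x)` in the universal algebra `A` is trapped between an upper bound found by
formal derivation and a lower bound found inside `B`; a search runs until the two nearly agree.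

Upper bounds. Judgments `‖p‖ ≤ r` are derived from the relations by five rules: sums, products,
scalars, axioms, and the C*-identity (from `‖w* w‖ ≤ t²` infer `‖w‖ ≤ t`). The rules are sound
(`norm_eval_derive_le`) and the derivable judgments can be enumerated. They are also complete
(`exists_derive_lt`): the infimum of the derivable bounds is a C*-seminorm on the free *-algebra
over `ℚ(i)`, and its completion is a C*-algebra in which the letters represent the relations. The
universal property gives a contractive *-homomorphism from `A` to it, so this infimum is at most
`‖p(x)‖`.

Lower bounds. Let `z` be a tuple of rational points of `B`. The algorithm of `B` can confirm that
`z` satisfies the relations up to a small error. Weak stability then moves `z` slightly to the image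
of `x` under a *-homomorphism `A → B`, so `‖p(z)‖ ≤ ‖p(x)‖ + ε` (`norm_eval_le_of_satisfiesUpTo`),
where the error comes from an explicit Lipschitz constant of `p`. Such tuples with `‖p(z)‖` close to
`‖p(x)‖` exist: `A` embeds isometrically in an ultrapower of `B`, where norms are limits of norms in
`B`, and rational points are dense (`exists_rational_tuple`).

A certificate is a pair of a derivation and a rational tuple whose bounds almost meet. Being a
certificate is decidable (`computable_isCertificate`), a certificate always exists
(`exists_isCertificate`), and any certificate gives the norm to the required precision
(`abs_sub_lt_of_isCertificate`). -/

namespace RatCode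

/-- The code of zero. -/
def zero : RatCode := (0, 0, 0)

/-- The code of one. -/
def one : RatCode := (1, 0, 0)

/-- Addition of codes. -/
def add (x y : RatCode) : RatCode :=
  (x.1 * (y.2.2 + 1) + y.1 * (x.2.2 + 1), x.2.1 * (y.2.2 + 1) + y.2.1 * (x.2.2 + 1),
    -- Denominators are stored minus one, and `(c + 1)(c' + 1) - 1 = cc' + c + c'`.
    x.2.2 * y.2.2 + x.2.2 + y.2.2)

/-- Multiplication of codes. -/
def mul (x y : RatCode) : RatCode :=
  (x.1 * y.1 + x.2.1 * y.2.1, x.1 * y.2.1 + x.2.1 * y.1, x.2.2 * y.2.2 + x.2.2 + y.2.2)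

/-- Negation of codes. -/
def neg (x : RatCode) : RatCode := (x.2.1, x.1, x.2.2)

/-- The order of the coded numbers. -/
def LE (x y : RatCode) : Prop :=
  -- Cross-multiplied, with the subtracted parts moved across so that everything stays in `ℕ`.
  x.1 * (y.2.2 + 1) + y.2.1 * (x.2.2 + 1) ≤ y.1 * (x.2.2 + 1) + x.2.1 * (y.2.2 + 1)

instance (x y : RatCode) : Decidable (LE x y) := inferInstanceAs (Decidable (_ ≤ _))

/-- The code of `2⁻ⁿ`. -/
def half (n : ℕ) : RatCode := (1, 0, 2 ^ n - 1)

theorem val_zero : val zero = 0 := by simp [val, zero]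

theorem val_one : val one = 1 := by simp [val, one]

theorem val_add (x y : RatCode) : val (add x y) = val x + val y := by
  have h1 : (x.2.2 : ℚ) + 1 ≠ 0 := by positivity
  have h2 : (y.2.2 : ℚ) + 1 ≠ 0 := by positivity
  have h3 : (x.2.2 : ℚ) * y.2.2 + x.2.2 + y.2.2 + 1 ≠ 0 := by positivity
  simp only [val, add]
  push_cast
  field_simp
  ring

theorem val_mul (x y : RatCode) : val (mul x y) = val x * val y := by
  have h1 : (x.2.2 : ℚ) + 1 ≠ 0 := by positivity
  have h2 : (y.2.2 : ℚ) + 1 ≠ 0 := by positivity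
  have h3 : (x.2.2 : ℚ) * y.2.2 + x.2.2 + y.2.2 + 1 ≠ 0 := by positivity
  simp only [val, mul]
  push_cast
  field_simp
  ring

theorem val_neg (x : RatCode) : val (neg x) = -val x := by
  simp only [val, neg]
  ring

theorem LE_iff (x y : RatCode) : LE x y ↔ val x ≤ val y := by
  have h1 : (0 : ℚ) < (x.2.2 : ℚ) + 1 := by positivity
  have h2 : (0 : ℚ) < (y.2.2 : ℚ) + 1 := by positivity
  rw [val, val, div_le_div_iff₀ h1 h2, LE, ← @Nat.cast_le ℚ]
  push_cast
  constructor <;> intro h <;> linarith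

theorem val_half (n : ℕ) : val (half n) = (2 : ℚ)⁻¹ ^ n := by
  have h : 1 ≤ 2 ^ n := Nat.one_le_two_pow
  simp [val, half, Nat.cast_sub h]

theorem exists_val_eq (q : ℚ) : ∃ x : RatCode, val x = q := by
  refine ⟨(q.num.toNat, (-q.num).toNat, q.den - 1), ?_⟩
  have h1 : ((q.num.toNat : ℤ) : ℚ) - (((-q.num).toNat : ℤ) : ℚ) = q.num := by
    exact_mod_cast Int.toNat_sub_toNat_neg q.num
  have h2 : ((q.den - 1 : ℕ) : ℚ) + 1 = q.den := by
    rw [Nat.cast_sub q.den_pos]; simp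
  simp only [val, h2]
  push_cast at h1
  rw [h1, Rat.num_div_den]

open Primrec in
theorem primrec_add : Primrec₂ add := by
  have f (g : RatCode → ℕ) (hg : Primrec g) : Primrec fun p : RatCode × RatCode => g p.1 :=
    hg.comp fst
  have f' (g : RatCode → ℕ) (hg : Primrec g) : Primrec fun p : RatCode × RatCode => g p.2 :=
    hg.comp snd
  have a := f _ fst
  have b := f _ (fst.comp snd)
  have c := f _ (snd.comp snd)
  have a' := f' _ fst
  have b' := f' _ (fst.comp snd)
  have c' := f' _ (snd.comp snd)
  exact Primrec.pair (nat_add.comp (nat_mul.comp a (succ.comp c')) (nat_mul.comp a' (succ.comp c)))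
    (Primrec.pair
      (nat_add.comp (nat_mul.comp b (succ.comp c')) (nat_mul.comp b' (succ.comp c)))
      (nat_add.comp (nat_add.comp (nat_mul.comp c c') c) c'))

open Primrec in
theorem primrec_mul : Primrec₂ mul := by
  have f (g : RatCode → ℕ) (hg : Primrec g) : Primrec fun p : RatCode × RatCode => g p.1 :=
    hg.comp fst
  have f' (g : RatCode → ℕ) (hg : Primrec g) : Primrec fun p : RatCode × RatCode => g p.2 :=
    hg.comp snd
  have a := f _ fst
  have b := f _ (fst.comp snd)
  have c := f _ (snd.comp snd)
  have a' := f' _ fst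
  have b' := f' _ (fst.comp snd)
  have c' := f' _ (snd.comp snd)
  exact Primrec.pair (nat_add.comp (nat_mul.comp a a') (nat_mul.comp b b'))
    (Primrec.pair
      (nat_add.comp (nat_mul.comp a b') (nat_mul.comp b a'))
      (nat_add.comp (nat_add.comp (nat_mul.comp c c') c) c'))

open Primrec in
theorem primrec_neg : Primrec neg :=
  Primrec.pair (fst.comp snd) (Primrec.pair fst (snd.comp snd))

open Primrec in
theorem primrec_LE : PrimrecRel LE := by
  have f (g : RatCode → ℕ) (hg : Primrec g) : Primrec fun p : RatCode × RatCode => g p.1 :=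
    hg.comp fst
  have f' (g : RatCode → ℕ) (hg : Primrec g) : Primrec fun p : RatCode × RatCode => g p.2 :=
    hg.comp snd
  have a := f _ fst
  have b := f _ (fst.comp snd)
  have c := f _ (snd.comp snd)
  have a' := f' _ fst
  have b' := f' _ (fst.comp snd)
  have c' := f' _ (snd.comp snd)
  exact nat_le.comp
    (nat_add.comp (nat_mul.comp a (succ.comp c')) (nat_mul.comp b' (succ.comp c)))
    (nat_add.comp (nat_mul.comp a' (succ.comp c)) (nat_mul.comp b (succ.comp c')))

theorem primrec_half : Primrec half := by
  have h : Primrec fun n : ℕ => 2 ^ n := by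
    refine (Primrec.nat_rec₁ 1 (f := fun _ x => 2 * x)
      (Primrec.nat_double.comp Primrec.snd)).of_eq fun n => ?_
    induction n with
    | zero => rfl
    | succ n ih => rw [pow_succ', ← ih]
  exact Primrec.pair (Primrec.const 1)
    (Primrec.pair (Primrec.const 0) (Primrec.nat_sub.comp h (Primrec.const 1)))

end RatCode

/-! ### Arithmetic of codes for `ℚ(i)` -/

namespace GaussCode

/-- The code of zero. -/
def zero : GaussCode := (RatCode.zero, RatCode.zero)

/-- The code of one. -/
def one : GaussCode := (RatCode.one, RatCode.zero)

/-- Addition of codes. -/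
def add (x y : GaussCode) : GaussCode := (RatCode.add x.1 y.1, RatCode.add x.2 y.2)

/-- Negation of codes. -/
def neg (x : GaussCode) : GaussCode := (RatCode.neg x.1, RatCode.neg x.2)

/-- Complex conjugation of codes. -/
def conj (x : GaussCode) : GaussCode := (x.1, RatCode.neg x.2)

/-- Multiplication of codes. -/
def mul (x y : GaussCode) : GaussCode :=
  (RatCode.add (RatCode.mul x.1 y.1) (RatCode.neg (RatCode.mul x.2 y.2)),
    RatCode.add (RatCode.mul x.1 y.2) (RatCode.mul x.2 y.1))

/-- The code of the square of the absolute value. -/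
def normSq (x : GaussCode) : RatCode := RatCode.add (RatCode.mul x.1 x.1) (RatCode.mul x.2 x.2)

/-- The coded number is zero. -/
def IsZero (x : GaussCode) : Prop := x.1.1 = x.1.2.1 ∧ x.2.1 = x.2.2.1

instance (x : GaussCode) : Decidable (IsZero x) := inferInstanceAs (Decidable (_ ∧ _))

/-- A natural number above the absolute value. -/
def absBound (x : GaussCode) : ℕ := (x.1.1 + x.1.2.1) + (x.2.1 + x.2.2.1)

theorem val_zero : val zero = 0 := by simp [val, zero, RatCode.val_zero]

theorem val_one : val one = 1 := by simp [val, one, RatCode.val_zero, RatCode.val_one]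

theorem val_add (x y : GaussCode) : val (add x y) = val x + val y := by
  simp only [val, add, RatCode.val_add]; push_cast; ring

theorem val_neg (x : GaussCode) : val (neg x) = -val x := by
  simp only [val, neg, RatCode.val_neg]; push_cast; ring

theorem val_conj (x : GaussCode) : val (conj x) = star (val x) := by
  simp [val, conj, RatCode.val_neg]

theorem val_mul (x y : GaussCode) : val (mul x y) = val x * val y := by
  simp only [val, mul, RatCode.val_add, RatCode.val_neg, RatCode.val_mul]
  push_cast
  linear_combination
    -((RatCode.val x.2 : ℚ) : ℂ) * ((RatCode.val y.2 : ℚ) : ℂ) * Complex.I_sq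

theorem val_re (x : GaussCode) : (val x).re = ((RatCode.val x.1 : ℚ) : ℝ) := by simp [val]

theorem val_im (x : GaussCode) : (val x).im = ((RatCode.val x.2 : ℚ) : ℝ) := by simp [val]

theorem val_normSq (x : GaussCode) : ((RatCode.val (normSq x) : ℚ) : ℝ) = ‖val x‖ ^ 2 := by
  rw [← Complex.normSq_eq_norm_sq, Complex.normSq_apply, val_re, val_im, normSq, RatCode.val_add,
    RatCode.val_mul, RatCode.val_mul]
  push_cast
  rfl

theorem isZero_iff (x : GaussCode) : IsZero x ↔ val x = 0 := by
  have h (y : RatCode) : y.1 = y.2.1 ↔ RatCode.val y = 0 := by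
    have h1 : (y.2.2 : ℚ) + 1 ≠ 0 := by positivity
    rw [RatCode.val, div_eq_zero_iff, or_iff_left h1, sub_eq_zero, Nat.cast_inj]
  rw [IsZero, h, h, Complex.ext_iff, val_re, val_im]
  simp

theorem norm_val_le (x : GaussCode) : ‖val x‖ ≤ absBound x := by
  have h (y : RatCode) : |((RatCode.val y : ℚ) : ℝ)| ≤ (y.1 + y.2.1 : ℕ) := by
    have h1 : (1 : ℝ) ≤ (y.2.2 : ℝ) + 1 := by simp
    simp only [RatCode.val]
    push_cast
    rw [abs_div, abs_of_nonneg (by positivity : (0 : ℝ) ≤ (y.2.2 : ℝ) + 1)]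
    refine (div_le_self (abs_nonneg _) h1).trans ((abs_sub _ _).trans ?_)
    simp
  refine (Complex.norm_le_abs_re_add_abs_im _).trans ?_
  rw [val_re, val_im, absBound]
  push_cast
  have h1 := h x.1
  have h2 := h x.2
  push_cast at h1 h2
  exact add_le_add h1 h2

/-- The coded complex numbers are dense. -/
theorem denseRange_val : DenseRange val := by
  rw [Metric.denseRange_iff]
  intro z r hr
  obtain ⟨a, ha1, ha2⟩ := exists_rat_btwn (show z.re - r / 2 < z.re by linarith)
  obtain ⟨b, hb1, hb2⟩ := exists_rat_btwn (show z.im - r / 2 < z.im by linarith)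
  obtain ⟨x, rfl⟩ := RatCode.exists_val_eq a
  obtain ⟨y, rfl⟩ := RatCode.exists_val_eq b
  refine ⟨(x, y), ?_⟩
  rw [dist_eq_norm]
  refine (Complex.norm_le_abs_re_add_abs_im _).trans_lt ?_
  rw [Complex.sub_re, Complex.sub_im, val_re, val_im, abs_of_pos (by linarith),
    abs_of_pos (by linarith)]
  linarith

theorem primrec_add : Primrec₂ add :=
  Primrec.pair (RatCode.primrec_add.comp (Primrec.fst.comp Primrec.fst)
    (Primrec.fst.comp Primrec.snd)) (RatCode.primrec_add.comp (Primrec.snd.comp Primrec.fst)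
    (Primrec.snd.comp Primrec.snd))

theorem primrec_neg : Primrec neg :=
  Primrec.pair (RatCode.primrec_neg.comp Primrec.fst) (RatCode.primrec_neg.comp Primrec.snd)

theorem primrec_conj : Primrec conj :=
  Primrec.pair Primrec.fst (RatCode.primrec_neg.comp Primrec.snd)

open Primrec in
theorem primrec_mul : Primrec₂ mul := by
  have a : Primrec fun p : GaussCode × GaussCode => p.1.1 := fst.comp fst
  have b : Primrec fun p : GaussCode × GaussCode => p.1.2 := snd.comp fst
  have a' : Primrec fun p : GaussCode × GaussCode => p.2.1 := fst.comp snd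
  have b' : Primrec fun p : GaussCode × GaussCode => p.2.2 := snd.comp snd
  exact Primrec.pair
    (RatCode.primrec_add.comp (RatCode.primrec_mul.comp a a')
      (RatCode.primrec_neg.comp (RatCode.primrec_mul.comp b b')))
    (RatCode.primrec_add.comp (RatCode.primrec_mul.comp a b') (RatCode.primrec_mul.comp b a'))

theorem primrec_normSq : Primrec normSq :=
  RatCode.primrec_add.comp (RatCode.primrec_mul.comp Primrec.fst Primrec.fst)
    (RatCode.primrec_mul.comp Primrec.snd Primrec.snd)

open Primrec in
theorem primrec_isZero : PrimrecPred IsZero :=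
  PrimrecPred.and (Primrec.eq.comp (fst.comp fst) (fst.comp (snd.comp fst)))
    (Primrec.eq.comp (fst.comp snd) (fst.comp (snd.comp snd)))

open Primrec in
theorem primrec_absBound : Primrec absBound :=
  nat_add.comp (nat_add.comp (fst.comp fst) (fst.comp (snd.comp fst)))
    (nat_add.comp (fst.comp snd) (fst.comp (snd.comp snd)))

end GaussCode

namespace RatPoly

variable {ι κ : Type}

/-! ### Operations on polynomial codes -/

/-- Multiplication of a polynomial code by a scalar code. -/
def smul (c : GaussCode) (p : RatPoly ι) : RatPoly ι := p.map fun t => (GaussCode.mul c t.1, t.2)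

/-- Product of polynomial codes. -/
def mul (p q : RatPoly ι) : RatPoly ι :=
  p.flatMap fun t => q.map fun s => (GaussCode.mul t.1 s.1, t.2 ++ s.2)

/-- Negation of polynomial codes. -/
def neg (p : RatPoly ι) : RatPoly ι := p.map fun t => (GaussCode.neg t.1, t.2)

/-- The adjoint of a letter. -/
def adjLetter (l : ι × Bool) : ι × Bool := (l.1, !l.2)

/-- Adjoint of polynomial codes. -/
def adj (p : RatPoly ι) : RatPoly ι :=
  p.map fun t => (GaussCode.conj t.1, (t.2.map adjLetter).reverse)

/-- The unit. -/
def one : RatPoly ι := [(GaussCode.one, [])]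

/-- A letter as a polynomial code. -/
def letter (l : ι × Bool) : RatPoly ι := [(GaussCode.one, [l])]

/-- Substitution of polynomials into a word. -/
def substWord (q : ι → RatPoly κ) (w : List (ι × Bool)) : RatPoly κ :=
  w.foldr (fun l acc => mul (bif l.2 then adj (q l.1) else q l.1) acc) one

/-- Substitution of polynomials into a polynomial. -/
def subst (q : ι → RatPoly κ) (p : RatPoly ι) : RatPoly κ :=
  p.flatMap fun t => smul t.1 (substWord q t.2)

section eval

variable {C : Type v} [CStarAlgebra C] (z : ι → C)

theorem eval_nil : eval [] z = 0 := rfl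

theorem eval_cons (t : GaussCode × List (ι × Bool)) (p : RatPoly ι) :
    eval (t :: p) z = GaussCode.val t.1 • (t.2.map (evalLetter z)).prod + eval p z := by
  simp [eval]

theorem eval_append (p q : RatPoly ι) : eval (p ++ q) z = eval p z + eval q z := by
  simp [eval]

theorem eval_one : eval one z = 1 := by simp [eval, one, GaussCode.val_one]

theorem eval_letter (l : ι × Bool) : eval (letter l) z = evalLetter z l := by
  simp [eval, letter, GaussCode.val_one]

theorem eval_smul (c : GaussCode) (p : RatPoly ι) :
    eval (smul c p) z = GaussCode.val c • eval p z := by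
  induction p with
  | nil => simp [smul, eval_nil]
  | cons t p ih =>
    rw [eval_cons, smul_add, ← ih]
    simp [smul, eval_cons, GaussCode.val_mul, mul_smul]

theorem eval_mul (p q : RatPoly ι) : eval (mul p q) z = eval p z * eval q z := by
  induction p with
  | nil => simp [mul, eval_nil]
  | cons t p ih =>
    have h : mul (t :: p) q =
        (q.map fun s => (GaussCode.mul t.1 s.1, t.2 ++ s.2)) ++ mul p q := by simp [mul]
    rw [h, eval_append, ih, eval_cons, add_mul]
    congr 1
    clear ih h
    induction q with
    | nil => simp [eval_nil]
    | cons s q ih =>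
      rw [List.map_cons, eval_cons, ih, eval_cons, mul_add]
      simp [GaussCode.val_mul, smul_smul, mul_comm]

theorem evalLetter_adjLetter (l : ι × Bool) :
    evalLetter z (adjLetter l) = star (evalLetter z l) := by
  rcases l with ⟨j, _ | _⟩ <;> simp [evalLetter, adjLetter]

theorem prod_adj_word (w : List (ι × Bool)) :
    (((w.map adjLetter).reverse).map (evalLetter z)).prod =
      star ((w.map (evalLetter z)).prod) := by
  induction w with
  | nil => simp
  | cons l w ih => simp [← ih, evalLetter_adjLetter]

theorem eval_adj (p : RatPoly ι) : eval (adj p) z = star (eval p z) := by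
  induction p with
  | nil => simp [adj, eval_nil]
  | cons t p ih =>
    rw [eval_cons, star_add, ← ih, star_smul, ← prod_adj_word, ← GaussCode.val_conj]
    exact eval_cons z _ _

theorem eval_substWord (q : κ → RatPoly ι) (w : List (κ × Bool)) :
    eval (substWord q w) z = (w.map (evalLetter fun j => eval (q j) z)).prod := by
  induction w with
  | nil => simp [substWord, eval_one]
  | cons l w ih =>
    have h : substWord q (l :: w) =
      mul (bif l.2 then adj (q l.1) else q l.1) (substWord q w) := rfl
    rw [h, eval_mul, ih, List.map_cons, List.prod_cons]
    rcases l with ⟨j, _ | _⟩ <;> simp [evalLetter, eval_adj]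

/-- A polynomial evaluated at rational points is again a rational point. The norm algorithm of `B`
can therefore be applied to relations evaluated at a rational tuple. -/
theorem eval_subst (q : κ → RatPoly ι) (p : RatPoly κ) :
    eval (subst q p) z = eval p fun j => eval (q j) z := by
  induction p with
  | nil => simp [subst, eval_nil]
  | cons t p ih =>
    have h : subst q (t :: p) = smul t.1 (substWord q t.2) ++ subst q p := by simp [subst]
    rw [h, eval_append, ih, eval_cons, eval_smul, eval_substWord]

theorem eval_map {D : Type u} [CStarAlgebra D] (φ : C →⋆ₐ[ℂ] D) (p : RatPoly ι) :
    φ (eval p z) = eval p fun j => φ (z j) := by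
  induction p with
  | nil => simp [eval_nil]
  | cons t p ih =>
    have h (l : ι × Bool) : φ (evalLetter z l) = evalLetter (fun j => φ (z j)) l := by
      rcases l with ⟨j, _ | _⟩ <;> simp [evalLetter, map_star]
    rw [eval_cons, eval_cons, map_add, ih, map_smul, map_list_prod, List.map_map]
    simp [Function.comp_def, h]

theorem continuous_eval (p : RatPoly ι) : Continuous fun z : ι → C => eval p z := by
  induction p with
  | nil => exact continuous_const
  | cons t p ih =>
    simp only [eval_cons]
    refine Continuous.add (Continuous.const_smul ?_ _) ih
    refine continuous_list_prod _ fun l _ => ?_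
    rcases l with ⟨j, _ | _⟩
    · simpa [evalLetter] using continuous_apply j
    · simpa [evalLetter] using (continuous_apply j).star

end eval

section primrec

variable [Primcodable ι] [Primcodable κ]

open Primrec

theorem primrec_smul : Primrec₂ (smul (ι := ι)) :=
  list_map snd ((Primrec.pair (GaussCode.primrec_mul.comp (fst.comp fst) (fst.comp snd))
    (snd.comp snd)).to₂)

theorem primrec_mul : Primrec₂ (mul (ι := ι)) := by
  refine list_flatMap fst (Primrec.to₂ (f := fun x : (RatPoly ι × RatPoly ι) ×
    (GaussCode × List (ι × Bool)) =>
      x.1.2.map fun s => (GaussCode.mul x.2.1 s.1, x.2.2 ++ s.2)) ?_)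
  refine list_map (snd.comp fst) ?_
  exact (Primrec.pair (GaussCode.primrec_mul.comp (fst.comp (snd.comp fst)) (fst.comp snd))
    (list_append.comp (snd.comp (snd.comp fst)) (snd.comp snd))).to₂

theorem primrec_neg : Primrec (neg (ι := ι)) :=
  list_map Primrec.id ((Primrec.pair (GaussCode.primrec_neg.comp (fst.comp snd))
    (snd.comp snd)).to₂)

theorem primrec_adjLetter : Primrec (adjLetter (ι := ι)) :=
  Primrec.pair fst (Primrec.not.comp snd)

theorem primrec_adj : Primrec (adj (ι := ι)) :=
  list_map Primrec.id ((Primrec.pair (GaussCode.primrec_conj.comp (fst.comp snd))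
    (list_reverse.comp (list_map (snd.comp snd) (primrec_adjLetter.comp snd).to₂))).to₂)

theorem primrec_substWord {k : ℕ} :
    Primrec₂ (substWord : (Fin k → RatPoly κ) → List (Fin k × Bool) → RatPoly κ) := by
  have h : Primrec fun y : ((Fin k → RatPoly κ) × List (Fin k × Bool)) ×
      ((Fin k × Bool) × RatPoly κ) => y.1.1 y.2.1.1 :=
    fin_app.comp (fst.comp fst) (fst.comp (fst.comp snd))
  refine list_foldr (α := (Fin k → RatPoly κ) × List (Fin k × Bool))
    (h := fun x y => mul (bif y.1.2 then adj (x.1 y.1.1) else x.1 y.1.1) y.2)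
    snd (Primrec.const one) ?_
  exact (primrec_mul.comp (Primrec.cond (snd.comp (fst.comp snd)) (primrec_adj.comp h) h)
    (snd.comp snd)).to₂

theorem primrec_subst {k : ℕ} :
    Primrec₂ (subst : (Fin k → RatPoly κ) → RatPoly (Fin k) → RatPoly κ) :=
  list_flatMap snd (primrec_smul.comp (fst.comp snd)
    (primrec_substWord.comp (fst.comp fst) (snd.comp snd))).to₂

end primrec

/-! ### Formal equality -/

section formal

variable [DecidableEq ι]

/-- The coefficient of a word. -/
def coeff (p : RatPoly ι) (w : List (ι × Bool)) : GaussCode :=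
  p.foldr (fun t acc => if t.2 = w then GaussCode.add t.1 acc else acc) GaussCode.zero

/-- Two codes describe the same noncommutative polynomial. -/
def FormalEq (p q : RatPoly ι) : Prop :=
  ∀ t ∈ p ++ neg q, GaussCode.IsZero (coeff (p ++ neg q) t.2)

instance (p q : RatPoly ι) : Decidable (FormalEq p q) := inferInstanceAs (Decidable (∀ t ∈ _, _))

open Primrec in
theorem primrec_coeff [Primcodable ι] : Primrec₂ (coeff (ι := ι)) :=
  list_foldr fst (Primrec.const GaussCode.zero) (Primrec.ite
    (Primrec.eq.comp (snd.comp (fst.comp snd)) (snd.comp fst))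
    (GaussCode.primrec_add.comp (fst.comp (fst.comp snd)) (snd.comp snd)) (snd.comp snd)).to₂

open Primrec in
theorem primrec_formalEq [Primcodable ι] : PrimrecRel (FormalEq (ι := ι)) := by
  have h : Primrec fun x : RatPoly ι × RatPoly ι => x.1 ++ neg x.2 :=
    list_append.comp fst (primrec_neg.comp snd)
  have h2 : PrimrecRel fun (t : GaussCode × List (ι × Bool)) (p : RatPoly ι) =>
      GaussCode.IsZero (coeff p t.2) :=
    GaussCode.primrec_isZero.comp (primrec_coeff.comp snd (snd.comp fst))
  exact h2.forall_mem_list.comp h h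

theorem coeff_cons (t : GaussCode × List (ι × Bool)) (p : RatPoly ι) (w : List (ι × Bool)) :
    coeff (t :: p) w = if t.2 = w then GaussCode.add t.1 (coeff p w) else coeff p w := rfl

theorem val_coeff_append (p q : RatPoly ι) (w : List (ι × Bool)) :
    GaussCode.val (coeff (p ++ q) w) = GaussCode.val (coeff p w) + GaussCode.val (coeff q w) := by
  induction p with
  | nil => simp [coeff, GaussCode.val_zero]
  | cons t p ih =>
    rw [List.cons_append, coeff_cons, coeff_cons]
    split_ifs <;> simp [GaussCode.val_add, ih, add_assoc]

theorem val_coeff_neg (p : RatPoly ι) (w : List (ι × Bool)) :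
    GaussCode.val (coeff (neg p) w) = -GaussCode.val (coeff p w) := by
  induction p with
  | nil => simp [coeff, neg, GaussCode.val_zero]
  | cons t p ih =>
    have h : neg (t :: p) = (GaussCode.neg t.1, t.2) :: neg p := rfl
    rw [h, coeff_cons, coeff_cons]
    split_ifs <;> simp [GaussCode.val_add, GaussCode.val_neg, ih]
    ring

theorem val_coeff_of_notMem (p : RatPoly ι) (w : List (ι × Bool)) (h : ∀ t ∈ p, t.2 ≠ w) :
    GaussCode.val (coeff p w) = 0 := by
  induction p with
  | nil => exact GaussCode.val_zero
  | cons t p ih =>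
    rw [coeff_cons, if_neg (h t (by simp))]
    exact ih fun s hs => h s (by simp [hs])

theorem formalEq_iff (p q : RatPoly ι) :
    FormalEq p q ↔ ∀ w, GaussCode.val (coeff p w) = GaussCode.val (coeff q w) := by
  constructor
  · intro h w
    rw [← sub_eq_zero, sub_eq_add_neg, ← val_coeff_neg, ← val_coeff_append]
    -- `FormalEq` tests only the finitely many words that occur; every other word has coefficient
    -- zero.
    by_cases hw : ∃ t ∈ p ++ neg q, t.2 = w
    · obtain ⟨t, ht, rfl⟩ := hw
      exact (GaussCode.isZero_iff _).1 (h t ht)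
    · push Not at hw
      exact val_coeff_of_notMem _ _ hw
  · intro h t _
    rw [GaussCode.isZero_iff, val_coeff_append, val_coeff_neg, h, add_neg_cancel]

end formal

end RatPoly

/-! ### The free *-algebra over the coded scalars -/

/-- The ring of coded complex numbers. -/
def codedScalars : Subring ℂ where
  carrier := Set.range GaussCode.val
  zero_mem' := ⟨_, GaussCode.val_zero⟩
  one_mem' := ⟨_, GaussCode.val_one⟩
  add_mem' := by rintro _ _ ⟨x, rfl⟩ ⟨y, rfl⟩; exact ⟨_, GaussCode.val_add x y⟩
  mul_mem' := by rintro _ _ ⟨x, rfl⟩ ⟨y, rfl⟩; exact ⟨_, GaussCode.val_mul x y⟩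
  neg_mem' := by rintro _ ⟨x, rfl⟩; exact ⟨_, GaussCode.val_neg x⟩

namespace codedScalars

noncomputable instance : StarRing codedScalars where
  star c := ⟨star (c : ℂ), by
    obtain ⟨_, x, rfl⟩ := c
    exact ⟨_, GaussCode.val_conj x⟩⟩
  star_involutive c := Subtype.ext (star_star (c : ℂ))
  star_mul c d := Subtype.ext (star_mul (c : ℂ) d)
  star_add c d := Subtype.ext (star_add (c : ℂ) d)

theorem coe_star (c : codedScalars) : ((star c : codedScalars) : ℂ) = star (c : ℂ) := rfl

/-- The scalar with a given code. -/
noncomputable def ofCode (c : GaussCode) : codedScalars := ⟨GaussCode.val c, c, rfl⟩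

theorem coe_ofCode (c : GaussCode) : (ofCode c : ℂ) = GaussCode.val c := rfl

theorem ofCode_surjective : Function.Surjective ofCode := by
  rintro ⟨_, x, rfl⟩
  exact ⟨x, rfl⟩

theorem denseRange_subtype : DenseRange codedScalars.subtype := by
  refine GaussCode.denseRange_val.mono ?_
  rintro _ ⟨x, rfl⟩
  exact ⟨ofCode x, rfl⟩

end codedScalars

/-- The monoid of words in the letters and their adjoints. -/
abbrev StarWord (ι : Type) : Type u := ULift.{u} (FreeMonoid (ι × Bool))

namespace StarWord

variable {ι : Type}

/-- The word with the given list of letters. -/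
def ofList (w : List (ι × Bool)) : StarWord.{u} ι := ⟨FreeMonoid.ofList w⟩

theorem ofList_injective : Function.Injective (ofList.{u} (ι := ι)) :=
  fun _ _ h => congrArg ULift.down h

theorem ofList_surjective : Function.Surjective (ofList.{u} (ι := ι)) := fun w => ⟨w.down, rfl⟩

theorem ofList_nil : ofList.{u} ([] : List (ι × Bool)) = 1 := rfl

theorem ofList_append (v w : List (ι × Bool)) : ofList.{u} (v ++ w) = ofList v * ofList w := rfl

instance : StarMul (StarWord.{u} ι) where
  star w := ofList (w.down.toList.map RatPoly.adjLetter).reverse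
  star_involutive := by
    rintro ⟨w⟩
    change ofList (((w.toList.map RatPoly.adjLetter).reverse.map RatPoly.adjLetter).reverse) =
      ofList w.toList
    simp [RatPoly.adjLetter, Function.comp_def]
  star_mul v w := by
    rw [← ofList_append]
    congr 1
    change ((v.down.toList ++ w.down.toList).map _).reverse = _
    simp

theorem star_ofList (w : List (ι × Bool)) :
    star (ofList.{u} w) = ofList (w.map RatPoly.adjLetter).reverse := rfl

end StarWord

namespace MonoidAlgebra

variable {K G : Type*} [CommRing K] [StarRing K] [Monoid G] [StarMul G]

/-- The additive involution `∑ c_g g ↦ ∑ c_g^* g^*`. -/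
noncomputable def starAddHom : MonoidAlgebra K G →+ MonoidAlgebra K G where
  toFun f := f.coeff.sum fun g c => single (star g) (star c)
  map_zero' := by simp
  map_add' f g := by
    rw [coeff_add]
    exact Finsupp.sum_add_index' (by simp) (by simp [single_add])

theorem starAddHom_single (g : G) (c : K) :
    starAddHom (single g c) = single (star g) (star c) := by
  change (single g c).coeff.sum (fun g c => single (star g) (star c)) = _
  rw [coeff_single, Finsupp.sum_single_index (by simp)]

/-- The *-ring structure for which group-like elements behave as in the monoid. -/
noncomputable abbrev starRing : StarRing (MonoidAlgebra K G) where
  star := starAddHom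
  star_involutive f := by
    change starAddHom (starAddHom f) = f
    induction f using MonoidAlgebra.induction_linear with
    | zero => simp
    | add f g hf hg => simp [hf, hg]
    | single g c => simp [starAddHom_single]
  star_mul f g := by
    change starAddHom (f * g) = starAddHom g * starAddHom f
    induction f using MonoidAlgebra.induction_linear with
    | zero => simp
    | add f f' hf hf' => simp [add_mul, mul_add, hf, hf']
    | single a c =>
      induction g using MonoidAlgebra.induction_linear with
      | zero => simp
      | add f f' hf hf' => simp [add_mul, mul_add, hf, hf']
      | single b d => simp [starAddHom_single, single_mul_single, mul_comm]
  star_add := map_add starAddHom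

end MonoidAlgebra

/-- The free *-algebra over the coded scalars. -/
abbrev FreeStarAlg (ι : Type) : Type u := MonoidAlgebra codedScalars (StarWord.{u} ι)

namespace RatPoly

variable {ι : Type}

/-- The element of the free *-algebra with a given code. -/
noncomputable def toFree (p : RatPoly ι) : FreeStarAlg.{u} ι :=
  (p.map fun t => MonoidAlgebra.single (StarWord.ofList t.2) (codedScalars.ofCode t.1)).sum

theorem toFree_nil : toFree.{u} ([] : RatPoly ι) = 0 := rfl

theorem toFree_cons (t : GaussCode × List (ι × Bool)) (p : RatPoly ι) :
    toFree.{u} (t :: p) =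
      MonoidAlgebra.single (StarWord.ofList t.2) (codedScalars.ofCode t.1) + toFree p := by
  simp [toFree]

theorem toFree_append (p q : RatPoly ι) : toFree.{u} (p ++ q) = toFree p + toFree q := by
  simp [toFree]

theorem toFree_mul (p q : RatPoly ι) : toFree.{u} (mul p q) = toFree p * toFree q := by
  induction p with
  | nil => simp [mul, toFree_nil]
  | cons t p ih =>
    have h : mul (t :: p) q =
        (q.map fun s => (GaussCode.mul t.1 s.1, t.2 ++ s.2)) ++ mul p q := by simp [mul]
    rw [h, toFree_append, ih, toFree_cons, add_mul]
    congr 1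
    clear ih h
    induction q with
    | nil => simp [toFree_nil]
    | cons s q ih =>
      rw [List.map_cons, toFree_cons, ih, toFree_cons, mul_add, MonoidAlgebra.single_mul_single,
        StarWord.ofList_append]
      congr 2
      exact Subtype.ext (GaussCode.val_mul _ _)

theorem toFree_adj (p : RatPoly ι) :
    toFree.{u} (adj p) = MonoidAlgebra.starAddHom (toFree p) := by
  induction p with
  | nil => simp [adj, toFree_nil]
  | cons t p ih =>
    have h : adj (t :: p) = (GaussCode.conj t.1, (t.2.map adjLetter).reverse) :: adj p := rfl
    rw [h, toFree_cons, toFree_cons, map_add, ih, MonoidAlgebra.starAddHom_single,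
      StarWord.star_ofList]
    congr 2
    exact Subtype.ext (GaussCode.val_conj _)

/-- Needed to name an arbitrary element of the free algebra in the conclusion of the C*-identity
rule. -/
theorem toFree_surjective : Function.Surjective (toFree.{u} (ι := ι)) := by
  intro f
  induction f using MonoidAlgebra.induction_linear with
  | zero => exact ⟨[], rfl⟩
  | add f g hf hg =>
    obtain ⟨p, rfl⟩ := hf
    obtain ⟨q, rfl⟩ := hg
    exact ⟨p ++ q, toFree_append p q⟩
  | single w c =>
    obtain ⟨w, rfl⟩ := StarWord.ofList_surjective w
    obtain ⟨c, rfl⟩ := codedScalars.ofCode_surjective c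
    exact ⟨[(c, w)], by simp [toFree]⟩

theorem coeff_toFree [DecidableEq ι] (p : RatPoly ι) (w : List (ι × Bool)) :
    (((toFree.{u} p).coeff (StarWord.ofList w) : codedScalars) : ℂ) =
      GaussCode.val (coeff p w) := by
  induction p with
  | nil => simp [toFree_nil, coeff, GaussCode.val_zero]
  | cons t p ih =>
    rw [toFree_cons, coeff_cons, MonoidAlgebra.coeff_add, Finsupp.add_apply, Subring.coe_add, ih,
      MonoidAlgebra.coeff_single]
    classical
    rw [Finsupp.single_apply]
    simp only [StarWord.ofList_injective.eq_iff]
    split_ifs <;> simp [GaussCode.val_add, codedScalars.coe_ofCode]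

/-- The decidable test on codes is equality in the free algebra, so derivability is a property of
free polynomials and not of their codes. -/
theorem formalEq_iff_toFree [DecidableEq ι] (p q : RatPoly ι) :
    FormalEq p q ↔ toFree.{u} p = toFree q := by
  rw [formalEq_iff]
  constructor
  · intro h
    ext w
    obtain ⟨w, rfl⟩ := StarWord.ofList_surjective w
    rw [coeff_toFree, coeff_toFree, h]
  · intro h w
    rw [← coeff_toFree.{u}, h, coeff_toFree]

/-- Evaluation depends only on the formal polynomial. -/
theorem FormalEq.eval_eq [DecidableEq ι] {p q : RatPoly ι} (h : FormalEq p q) {C : Type v}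
    [CStarAlgebra C] (z : ι → C) : eval p z = eval q z := by
  -- Evaluation factors through the free algebra; only additivity of the factor is needed.
  let E : FreeStarAlg.{0} ι → C := fun f => f.coeff.sum fun w c =>
    (c : ℂ) • (w.down.toList.map (evalLetter z)).prod
  have hE (p : RatPoly ι) : E (toFree p) = eval p z := by
    induction p with
    | nil => simp [E, toFree_nil, eval_nil]
    | cons t p ih =>
      have hadd (f g : FreeStarAlg.{0} ι) : E (f + g) = E f + E g :=
        Finsupp.sum_add_index' (by simp) (by simp [add_smul])
      rw [toFree_cons, eval_cons, hadd, ih]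
      congr 1
      simp only [E, MonoidAlgebra.coeff_single]
      rw [Finsupp.sum_single_index (by simp)]
      rfl
  rw [← hE, ← hE, (formalEq_iff_toFree p q).1 h]

end RatPoly

/-! ### Completion of a C*-seminorm -/

open UniformSpace in
/-- A *-ring over the coded scalars with a C*-seminorm maps isometrically into a C*-algebra. -/
theorem exists_cstarAlgebra_of_seminormedRing (F : Type u) [SeminormedRing F] [StarRing F]
    [Algebra codedScalars F] (hK : ∀ c : codedScalars, ‖algebraMap codedScalars F c‖ ≤ ‖(c : ℂ)‖)
    (hKs : ∀ c : codedScalars,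
      star (algebraMap codedScalars F c) = algebraMap codedScalars F (star c))
    (hstar : ∀ f : F, ‖star f‖ ≤ ‖f‖) (hC : ∀ f : F, ‖f‖ * ‖f‖ ≤ ‖star f * f‖) :
    ∃ (D : Type u) (_ : CStarAlgebra D) (ψ : F →+* D),
      (∀ c : codedScalars, ψ (algebraMap codedScalars F c) = algebraMap ℂ D c) ∧
      (∀ f, ψ (star f) = star (ψ f)) ∧ ∀ f, ‖ψ f‖ = ‖f‖ := by
  have : NormedStarGroup F := ⟨hstar⟩
  have hsu : UniformContinuous (star : F → F) := star_isometry.uniformContinuous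
  have hcs : Continuous (Completion.map (star : F → F)) := Completion.continuous_map
  have hs (f : F) : Completion.map (star : F → F) (f : Completion F) = ((star f : F) : _) :=
    Completion.map_coe hsu f
  let _ : StarRing (Completion F) :=
    { star := Completion.map star
      star_involutive := fun x => by
        induction x using Completion.induction_on with
        | hp => exact isClosed_eq (hcs.comp hcs) continuous_id
        | ih f => rw [hs, hs, star_star]
      star_mul := fun x y => by
        change Completion.map star (x * y) = Completion.map star y * Completion.map star x
        induction x, y using Completion.induction_on₂ with
        | hp => exact isClosed_eq (hcs.comp (by fun_prop)) (by fun_prop)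
        | ih f g => rw [← Completion.coe_mul, hs, hs, hs, star_mul, Completion.coe_mul]
      star_add := fun x y => by
        change Completion.map star (x + y) = Completion.map star x + Completion.map star y
        induction x, y using Completion.induction_on₂ with
        | hp => exact isClosed_eq (hcs.comp (by fun_prop)) (by fun_prop)
        | ih f g => rw [← Completion.coe_add, hs, hs, hs, star_add, Completion.coe_add] }
  have hs' (f : F) : star (f : Completion F) = ((star f : F) : Completion F) := hs f
  have hcs' : Continuous (star : Completion F → Completion F) := hcs
  have hui : IsUniformInducing codedScalars.subtype := isUniformInducing_val _
  let e0 : codedScalars →+* Completion F := Completion.coeRingHom.comp (algebraMap codedScalars F)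
  have he0 (c : codedScalars) : ‖e0 c‖ ≤ ‖(c : ℂ)‖ := by
    change ‖((algebraMap codedScalars F c : F) : Completion F)‖ ≤ _
    rw [Completion.norm_coe]
    exact hK c
  have hu : UniformContinuous e0 :=
    AddMonoidHomClass.uniformContinuous_of_bound e0 1 fun c => by
      rw [one_mul]
      exact he0 c
  have hd := codedScalars.denseRange_subtype
  -- The coded scalars are dense in `ℂ` and act by a contraction, so the scalar action extends to
  -- `ℂ` by uniform continuity. Centrality, the norm bound and compatibility with the adjoint pass
  -- to the limit.
  let e : ℂ →+* Completion F := IsDenseInducing.extendRingHom hui hd hu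
  have hec : Continuous e := (uniformContinuous_uniformly_extend hui hd hu).continuous
  have he (c : codedScalars) : e c = ((algebraMap codedScalars F c : F) : Completion F) :=
    uniformly_extend_of_ind hui hd hu c
  have hcomm (c : ℂ) (x : Completion F) : e c * x = x * e c := by
    refine hd.induction_on (p := fun c => ∀ x, e c * x = x * e c) c ?_ ?_ x
    · simp only [Set.ofPred_forall]
      exact isClosed_iInter fun x => isClosed_eq (by fun_prop) (by fun_prop)
    · intro c x
      induction x using Completion.induction_on with
      | hp => exact isClosed_eq (by fun_prop) (by fun_prop)
      | ih f =>
        rw [codedScalars.subtype_apply, he, ← Completion.coe_mul, ← Completion.coe_mul,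
          Algebra.commutes]
  have hnorm (c : ℂ) : ‖e c‖ ≤ ‖c‖ := by
    refine hd.induction_on (p := fun c => ‖e c‖ ≤ ‖c‖) c
      (isClosed_le (by fun_prop) (by fun_prop)) fun c => ?_
    rw [codedScalars.subtype_apply, he]
    exact he0 c
  have hes (c : ℂ) : star (e c) = e (star c) := by
    refine hd.induction_on (p := fun c => star (e c) = e (star c)) c
      (isClosed_eq (by fun_prop) (by fun_prop)) fun c => ?_
    rw [codedScalars.subtype_apply, ← codedScalars.coe_star, he, he, hs', hKs]
  let _ : Algebra ℂ (Completion F) := e.toAlgebra' hcomm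
  have hsm (c : ℂ) (x : Completion F) : c • x = e c * x := rfl
  let _ : NormedAlgebra ℂ (Completion F) :=
    { norm_smul_le := fun c x => by
        rw [hsm]
        exact (norm_mul_le _ _).trans (mul_le_mul_of_nonneg_right (hnorm c) (norm_nonneg x)) }
  have : CStarRing (Completion F) :=
    { norm_mul_self_le := fun x => by
        induction x using Completion.induction_on with
        | hp => exact isClosed_le (by fun_prop) (by fun_prop)
        | ih f =>
          rw [hs', ← Completion.coe_mul, Completion.norm_coe, Completion.norm_coe]
          exact hC f }
  have : StarModule ℂ (Completion F) :=
    { star_smul := fun c x => by rw [hsm, hsm, star_mul, hes, hcomm] }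
  exact ⟨Completion F, { }, Completion.coeRingHom, fun c => (he c).symm, fun f => (hs' f).symm,
    fun f => Completion.norm_coe f⟩

/-! ### Judgments on norms -/

/-- A judgment `(p, r)`, to be read as `‖p(x)‖ ≤ r`. -/
abbrev NormJudgment (k : ℕ) : Type := RatPoly (Fin k) × RatCode

/-- The rational code of a dyadic number. -/
def DyadicCode.toRat (d : DyadicCode) : RatCode := (d.1, 0, 2 ^ d.2 - 1)

theorem DyadicCode.val_toRat (d : DyadicCode) :
    ((RatCode.val d.toRat : ℚ) : ℝ) = DyadicCode.val d := by
  have h : 1 ≤ 2 ^ d.2 := Nat.one_le_two_pow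
  simp [RatCode.val, DyadicCode.toRat, DyadicCode.val, Nat.cast_sub h]

namespace FiniteRationalRelations

variable {k : ℕ} (R : FiniteRationalRelations k)

/-- The relations as a list of judgments. -/
def judgments : List (NormJudgment k) :=
  (R.rels.map fun r => (r.1, r.2.toRat)) ++ (List.finRange k).flatMap fun j =>
    [(RatPoly.letter (j, false), (R.bound j).toRat), (RatPoly.letter (j, true), (R.bound j).toRat)]

theorem satisfiesUpTo_iff {C : Type v} [CStarAlgebra C] (z : Fin k → C) (δ : ℝ) :
    R.SatisfiesUpTo z δ ↔
      ∀ x ∈ R.judgments, ‖x.1.eval z‖ ≤ ((RatCode.val x.2 : ℚ) : ℝ) + δ := by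
  simp only [judgments, List.mem_append, List.mem_map, List.mem_flatMap, List.mem_finRange,
    true_and, List.mem_cons, List.not_mem_nil, or_false]
  constructor
  · rintro ⟨h1, h2⟩ x (⟨r, hr, rfl⟩ | ⟨j, rfl | rfl⟩)
    · simpa [DyadicCode.val_toRat] using h1 r hr
    · simpa [DyadicCode.val_toRat, RatPoly.eval_letter, evalLetter] using h2 j
    · simpa [DyadicCode.val_toRat, RatPoly.eval_letter, evalLetter] using h2 j
  · intro h
    refine ⟨fun r hr => ?_, fun j => ?_⟩
    · simpa [DyadicCode.val_toRat] using h _ (Or.inl ⟨r, hr, rfl⟩)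
    · simpa [DyadicCode.val_toRat, RatPoly.eval_letter, evalLetter] using
        h _ (Or.inr ⟨j, Or.inl rfl⟩)

theorem isRepresentation_iff {C : Type v} [CStarAlgebra C] (z : Fin k → C) :
    R.IsRepresentation z ↔
      ∀ x ∈ R.judgments, ‖x.1.eval z‖ ≤ ((RatCode.val x.2 : ℚ) : ℝ) := by
  have h := R.satisfiesUpTo_iff z 0
  simpa [SatisfiesUpTo, IsRepresentation] using h

end FiniteRationalRelations

/-! ### Derivations of norm bounds -/

section enumerate

variable {I X : Type*}

/-- An enumeration of the closure of `{x₀}` under the binary operations `step i`. -/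
def enumerateClosure [Encodable I] [Inhabited I] (x₀ : X) (step : I → X → X → X) : ℕ → X
  | 0 => x₀
  -- `n` codes a rule and the indices of two premises; both indices are at most `n`, hence earlier.
  | n + 1 =>
    step ((Encodable.decode n.unpair.1).getD default)
      (enumerateClosure x₀ step n.unpair.2.unpair.1) (enumerateClosure x₀ step n.unpair.2.unpair.2)
  decreasing_by
  · exact Nat.lt_succ_of_le ((Nat.unpair_left_le _).trans (Nat.unpair_right_le _))
  · exact Nat.lt_succ_of_le ((Nat.unpair_right_le _).trans (Nat.unpair_right_le _))

theorem enumerateClosure_zero [Encodable I] [Inhabited I] (x₀ : X) (step : I → X → X → X) :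
    enumerateClosure x₀ step 0 = x₀ := by rw [enumerateClosure]

theorem enumerateClosure_succ [Encodable I] [Inhabited I] (x₀ : X) (step : I → X → X → X)
    (n : ℕ) : enumerateClosure x₀ step (n + 1) =
      step ((Encodable.decode n.unpair.1).getD default)
        (enumerateClosure x₀ step n.unpair.2.unpair.1)
        (enumerateClosure x₀ step n.unpair.2.unpair.2) := by rw [enumerateClosure]

theorem exists_enumerateClosure_eq [Encodable I] [Inhabited I] (x₀ : X) (step : I → X → X → X)
    (i : I) (m n : ℕ) : ∃ l, enumerateClosure x₀ step l =
      step i (enumerateClosure x₀ step m) (enumerateClosure x₀ step n) :=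
  ⟨Nat.pair (Encodable.encode i) (Nat.pair m n) + 1, by simp [enumerateClosure_succ]⟩

theorem enumerateClosure_induction [Encodable I] [Inhabited I] {x₀ : X} {step : I → X → X → X}
    {p : X → Prop} (h0 : p x₀) (hs : ∀ i x y, p x → p y → p (step i x y)) (n : ℕ) :
    p (enumerateClosure x₀ step n) := by
  induction n using Nat.strong_induction_on with
  | _ n ih =>
    cases n with
    | zero => rwa [enumerateClosure_zero]
    | succ n =>
      rw [enumerateClosure_succ]
      exact hs _ _ _
        (ih _ (Nat.lt_succ_of_le ((Nat.unpair_left_le _).trans (Nat.unpair_right_le _))))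
        (ih _ (Nat.lt_succ_of_le ((Nat.unpair_right_le _).trans (Nat.unpair_right_le _))))

open Primrec in
-- Course-of-values recursion: the value at `n` is computed from the list of all earlier values.
theorem primrec_enumerateClosure [Primcodable I] [Inhabited I] [Primcodable X] (x₀ : X)
    {step : I → X → X → X} (hstep : Primrec fun a : I × X × X => step a.1 a.2.1 a.2.2) :
    Primrec (enumerateClosure x₀ step) := by
  let g : Unit → List X → Option X := fun _ l =>
    if l.length = 0 then some x₀ else
      some (step ((Encodable.decode (l.length - 1).unpair.1).getD default)
        -- The default `x₀` is never used, since both premise indices are smaller than the length of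
        -- the list.
        (l.getD (l.length - 1).unpair.2.unpair.1 x₀)
        (l.getD (l.length - 1).unpair.2.unpair.2 x₀))
  have hg : Primrec₂ g := by
    have hl : Primrec fun a : Unit × List X => a.2.length := list_length.comp snd
    have hn : Primrec fun a : Unit × List X => (a.2.length - 1).unpair :=
      unpair.comp (nat_sub.comp hl (Primrec.const 1))
    have hm := unpair.comp (snd.comp hn)
    refine Primrec.ite (Primrec.eq.comp hl (Primrec.const 0)) (Primrec.const _) ?_
    refine option_some.comp (hstep.comp (Primrec.pair ?_ (Primrec.pair ?_ ?_)))
    · exact option_getD.comp (Primrec.decode.comp (fst.comp hn)) (Primrec.const default)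
    · exact (list_getD _).comp snd (fst.comp hm)
    · exact (list_getD _).comp snd (snd.comp hm)
  refine (nat_strong_rec (fun _ : Unit => enumerateClosure x₀ step) hg fun _ n => ?_).comp
    (Primrec.const ()) Primrec.id
  cases n with
  | zero => simp [g, enumerateClosure_zero]
  | succ n =>
    have h1 : n.unpair.2.unpair.1 < n + 1 :=
      Nat.lt_succ_of_le ((Nat.unpair_left_le _).trans (Nat.unpair_right_le _))
    have h2 : n.unpair.2.unpair.2 < n + 1 :=
      Nat.lt_succ_of_le ((Nat.unpair_right_le _).trans (Nat.unpair_right_le _))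
    rw [enumerateClosure_succ]
    simp [g, List.getD_eq_getElem?_getD, h1, h2]

end enumerate

namespace NormJudgment

variable {k : ℕ}

/-- One inference: addition, multiplication, the C*-identity, a scalar, or an axiom. -/
def step (axs : List (NormJudgment k)) (i : ℕ × NormJudgment k × ℕ) (x y : NormJudgment k) :
    NormJudgment k :=
  if i.1 = 0 then (x.1 ++ y.1, RatCode.add x.2 y.2)
  else if i.1 = 1 then (RatPoly.mul x.1 y.1, RatCode.mul x.2 y.2)
  -- The conclusion `(w, t)` is guessed and then checked: the square root of a rational bound need
  -- not be rational, so any rational `t ≥ 0` with `t²` above the bound is accepted.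
  else if i.1 = 2 ∧ RatCode.LE RatCode.zero i.2.1.2 ∧
      RatCode.LE x.2 (RatCode.mul i.2.1.2 i.2.1.2) ∧
      RatPoly.FormalEq x.1 (RatPoly.mul (RatPoly.adj i.2.1.1) i.2.1.1) then i.2.1
  else if i.1 = 3 ∧ RatCode.LE RatCode.zero i.2.1.2 ∧
      RatCode.LE (GaussCode.normSq i.2.1.1.headI.1) (RatCode.mul i.2.1.2 i.2.1.2) then
    ([(i.2.1.1.headI.1, [])], i.2.1.2)
  -- Failed side conditions also end here; an index out of range gives the true judgment `‖0‖ ≤ 0`.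
  else axs.getD i.2.2 ([], RatCode.zero)

/-- An enumeration of all judgments that can be derived from `axs`. -/
def derive (axs : List (NormJudgment k)) : ℕ → NormJudgment k :=
  enumerateClosure ([], RatCode.zero) (step axs)

theorem derive_zero (axs : List (NormJudgment k)) : derive axs 0 = ([], RatCode.zero) :=
  enumerateClosure_zero _ _

theorem exists_derive_eq_step (axs : List (NormJudgment k)) (i : ℕ × NormJudgment k × ℕ)
    (m n : ℕ) : ∃ l, derive axs l = step axs i (derive axs m) (derive axs n) :=
  exists_enumerateClosure_eq _ _ i m n

section primrec

open Primrec

theorem primrec_step (axs : List (NormJudgment k)) :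
    Primrec fun a : (ℕ × NormJudgment k × ℕ) × NormJudgment k × NormJudgment k =>
      step axs a.1 a.2.1 a.2.2 := by
  let α := (ℕ × NormJudgment k × ℕ) × NormJudgment k × NormJudgment k
  have hi : Primrec fun a : α => a.1.1 := fst.comp fst
  have hw : Primrec fun a : α => a.1.2.1.1 := fst.comp (fst.comp (snd.comp fst))
  have ht : Primrec fun a : α => a.1.2.1.2 := snd.comp (fst.comp (snd.comp fst))
  have hidx : Primrec fun a : α => a.1.2.2 := snd.comp (snd.comp fst)
  have hp : Primrec fun a : α => a.2.1.1 := fst.comp (fst.comp snd)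
  have hr : Primrec fun a : α => a.2.1.2 := snd.comp (fst.comp snd)
  have hq : Primrec fun a : α => a.2.2.1 := fst.comp (snd.comp snd)
  have hs : Primrec fun a : α => a.2.2.2 := snd.comp (snd.comp snd)
  have hc : Primrec fun a : α => a.1.2.1.1.headI.1 := fst.comp (list_headI.comp hw)
  have htt : Primrec fun a : α => RatCode.mul a.1.2.1.2 a.1.2.1.2 :=
    RatCode.primrec_mul.comp ht ht
  have hpos : PrimrecPred fun a : α => RatCode.LE RatCode.zero a.1.2.1.2 :=
    RatCode.primrec_LE.comp (Primrec.const _) ht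
  have heq (n : ℕ) : PrimrecPred fun a : α => a.1.1 = n := Primrec.eq.comp hi (Primrec.const n)
  refine Primrec.ite (heq 0)
    (Primrec.pair (list_append.comp hp hq) (RatCode.primrec_add.comp hr hs)) ?_
  refine Primrec.ite (heq 1)
    (Primrec.pair (RatPoly.primrec_mul.comp hp hq) (RatCode.primrec_mul.comp hr hs)) ?_
  refine Primrec.ite ((heq 2).and (hpos.and ((RatCode.primrec_LE.comp hr htt).and
    (RatPoly.primrec_formalEq.comp hp
      (RatPoly.primrec_mul.comp (RatPoly.primrec_adj.comp hw) hw)))))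
    (fst.comp (snd.comp fst)) ?_
  refine Primrec.ite ((heq 3).and (hpos.and
    (RatCode.primrec_LE.comp (GaussCode.primrec_normSq.comp hc) htt)))
    (Primrec.pair (list_cons.comp (Primrec.pair hc (Primrec.const [])) (Primrec.const [])) ht) ?_
  exact (list_getD _).comp (Primrec.const axs) hidx

theorem primrec_derive (axs : List (NormJudgment k)) : Primrec (derive axs) :=
  primrec_enumerateClosure _ (primrec_step axs)

end primrec

/-! ### Soundness -/

/-- Every rule preserves truth. Applied to the generators of `A`, this yields the upper bounds and
also shows that derived bounds are never negative. -/
theorem norm_eval_derive_le (axs : List (NormJudgment k)) {C : Type v} [CStarAlgebra C]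
    [Nontrivial C] (z : Fin k → C)
    (hz : ∀ x ∈ axs, ‖x.1.eval z‖ ≤ ((RatCode.val x.2 : ℚ) : ℝ)) (n : ℕ) :
    ‖(derive axs n).1.eval z‖ ≤ ((RatCode.val (derive axs n).2 : ℚ) : ℝ) := by
  have h0 : ‖RatPoly.eval [] z‖ ≤ ((RatCode.val RatCode.zero : ℚ) : ℝ) := by
    simp [RatPoly.eval_nil, RatCode.val_zero]
  have hpos {t : RatCode} (ht : RatCode.LE RatCode.zero t) :
      (0 : ℝ) ≤ ((RatCode.val t : ℚ) : ℝ) := by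
    rw [RatCode.LE_iff, RatCode.val_zero] at ht
    exact_mod_cast ht
  refine enumerateClosure_induction
    (p := fun x : NormJudgment k => ‖x.1.eval z‖ ≤ ((RatCode.val x.2 : ℚ) : ℝ)) h0
    (fun i x y hx hy => ?_) n
  unfold step
  split_ifs with h1 h2 h3 h4
  · rw [RatPoly.eval_append, RatCode.val_add, Rat.cast_add]
    exact (norm_add_le _ _).trans (add_le_add hx hy)
  · rw [RatPoly.eval_mul, RatCode.val_mul, Rat.cast_mul]
    exact (norm_mul_le _ _).trans
      (mul_le_mul hx hy (norm_nonneg _) ((norm_nonneg _).trans hx))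
  · obtain ⟨-, ht, hle, heq⟩ := h3
    rw [heq.eval_eq, RatPoly.eval_mul, RatPoly.eval_adj, CStarRing.norm_star_mul_self] at hx
    rw [RatCode.LE_iff, RatCode.val_mul] at hle
    have hle' := hx.trans (Rat.cast_le.2 hle)
    rw [Rat.cast_mul] at hle'
    exact (mul_self_le_mul_self_iff (norm_nonneg _) (hpos ht)).2 hle'
  · obtain ⟨-, ht, hle⟩ := h4
    rw [RatCode.LE_iff, RatCode.val_mul, ← Rat.cast_le (K := ℝ), GaussCode.val_normSq,
      Rat.cast_mul, sq] at hle
    have := (mul_self_le_mul_self_iff (norm_nonneg _) (hpos ht)).2 hle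
    simpa [RatPoly.eval, norm_smul] using this
  · rw [List.getD_eq_getElem?_getD]
    cases h : axs[i.2.2]? with
    | none => exact h0
    | some x => exact hz x (List.mem_of_getElem? h)

/-! ### Completeness -/

/-- The norm of `f` can be shown to be at most `r`. -/
def Bounds (axs : List (NormJudgment k)) (f : FreeStarAlg.{u} (Fin k)) (r : ℝ) : Prop :=
  ∃ n, RatPoly.toFree (derive axs n).1 = f ∧ ((RatCode.val (derive axs n).2 : ℚ) : ℝ) ≤ r

namespace Bounds

variable {axs : List (NormJudgment k)} {f g : FreeStarAlg.{u} (Fin k)} {r s : ℝ}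

theorem mono (h : Bounds axs f r) (hrs : r ≤ s) : Bounds axs f s :=
  let ⟨n, h1, h2⟩ := h
  ⟨n, h1, h2.trans hrs⟩

theorem zero : Bounds axs (0 : FreeStarAlg.{u} (Fin k)) 0 :=
  ⟨0, by simp [derive_zero, RatPoly.toFree_nil], by simp [derive_zero, RatCode.val_zero]⟩

theorem add (hf : Bounds axs f r) (hg : Bounds axs g s) : Bounds axs (f + g) (r + s) := by
  obtain ⟨m, rfl, hm⟩ := hf
  obtain ⟨n, rfl, hn⟩ := hg
  obtain ⟨l, hl⟩ := exists_derive_eq_step axs (0, default, 0) m n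
  refine ⟨l, ?_, ?_⟩
  · simp [hl, step, RatPoly.toFree_append]
  · simpa [hl, step, RatCode.val_add] using add_le_add hm hn

theorem mul (h0 : ∀ n, 0 ≤ RatCode.val (derive axs n).2) (hf : Bounds axs f r)
    (hg : Bounds axs g s) : Bounds axs (f * g) (r * s) := by
  obtain ⟨m, rfl, hm⟩ := hf
  obtain ⟨n, rfl, hn⟩ := hg
  obtain ⟨l, hl⟩ := exists_derive_eq_step axs (1, default, 0) m n
  have hm0 : (0 : ℝ) ≤ ((RatCode.val (derive axs m).2 : ℚ) : ℝ) := by exact_mod_cast h0 m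
  have hn0 : (0 : ℝ) ≤ ((RatCode.val (derive axs n).2 : ℚ) : ℝ) := by exact_mod_cast h0 n
  refine ⟨l, ?_, ?_⟩
  · simp [hl, step, RatPoly.toFree_mul]
  · simpa [hl, step, RatCode.val_mul] using mul_le_mul hm hn hn0 (hm0.trans hm)

/-- The strict inequality leaves room for a rational `t` with `√r < t < s`, which serves as the
guessed conclusion of the C*-identity rule. -/
theorem of_starAddHom_mul_self (hf : Bounds axs (MonoidAlgebra.starAddHom f * f) r)
    (hs : 0 < s) (hrs : r < s ^ 2) : Bounds axs f s := by
  obtain ⟨m, hm, hmr⟩ := hf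
  obtain ⟨w, rfl⟩ := RatPoly.toFree_surjective f
  obtain ⟨q, hq1, hq2⟩ := exists_rat_btwn
    (show √(max r 0) < s from (Real.sqrt_lt' hs).2 (max_lt hrs (by positivity)))
  obtain ⟨t, rfl⟩ := RatCode.exists_val_eq q
  have ht : (0 : ℝ) < ((RatCode.val t : ℚ) : ℝ) := (Real.sqrt_nonneg _).trans_lt hq1
  have hrt : r ≤ ((RatCode.val t : ℚ) : ℝ) * ((RatCode.val t : ℚ) : ℝ) := by
    have := (Real.sqrt_lt' ht).1 hq1
    rw [← sq]
    exact (le_max_left r 0).trans this.le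
  obtain ⟨l, hl⟩ := exists_derive_eq_step axs (2, (w, t), 0) m m
  have h1 : RatCode.LE RatCode.zero t := by
    rw [RatCode.LE_iff, RatCode.val_zero]
    exact_mod_cast ht.le
  have h2 : RatCode.LE (derive axs m).2 (RatCode.mul t t) := by
    rw [RatCode.LE_iff, RatCode.val_mul, ← Rat.cast_le (K := ℝ), Rat.cast_mul]
    exact hmr.trans hrt
  have h3 : RatPoly.FormalEq (derive axs m).1 (RatPoly.mul (RatPoly.adj w) w) := by
    rw [RatPoly.formalEq_iff_toFree.{u}, hm, RatPoly.toFree_mul, RatPoly.toFree_adj]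
  have hl' : derive axs l = (w, t) := by simp [hl, step, h1, h2, h3]
  exact ⟨l, by rw [hl'], by rw [hl']; exact hq2.le⟩

/-- `‖c‖` may be irrational, so only strict upper bounds are claimed. -/
theorem algebraMap (c : codedScalars) (hr : ‖(c : ℂ)‖ < r) :
    Bounds axs (algebraMap codedScalars (FreeStarAlg.{u} (Fin k)) c) r := by
  obtain ⟨c, rfl⟩ := codedScalars.ofCode_surjective c
  rw [codedScalars.coe_ofCode] at hr
  obtain ⟨q, hq1, hq2⟩ := exists_rat_btwn hr
  obtain ⟨t, rfl⟩ := RatCode.exists_val_eq q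
  obtain ⟨l, hl⟩ := exists_derive_eq_step axs (3, ([(c, [])], t), 0) 0 0
  have h1 : RatCode.LE RatCode.zero t := by
    rw [RatCode.LE_iff, RatCode.val_zero]
    exact_mod_cast (norm_nonneg _).trans hq1.le
  have h2 : RatCode.LE (GaussCode.normSq c) (RatCode.mul t t) := by
    rw [RatCode.LE_iff, RatCode.val_mul, ← Rat.cast_le (K := ℝ), GaussCode.val_normSq,
      Rat.cast_mul, sq]
    exact mul_self_le_mul_self (norm_nonneg _) hq1.le
  have hl' : derive axs l = ([(c, [])], t) := by simp [hl, step, h1, h2]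
  refine ⟨l, ?_, by rw [hl']; exact hq2.le⟩
  rw [hl', RatPoly.toFree_cons, RatPoly.toFree_nil, add_zero, StarWord.ofList_nil]
  rfl

theorem of_mem {x : NormJudgment k} (hx : x ∈ axs) :
    Bounds axs (RatPoly.toFree.{u} x.1) ((RatCode.val x.2 : ℚ) : ℝ) := by
  obtain ⟨n, hn, rfl⟩ := List.getElem_of_mem hx
  -- A rule number above 3 selects the axiom branch.
  obtain ⟨l, hl⟩ := exists_derive_eq_step axs (4, default, n) 0 0
  have hl' : derive axs l = axs[n] := by simp [hl, step, hn]
  exact ⟨l, by rw [hl'], by rw [hl']⟩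

/-- Makes the infimum of the derivable bounds meaningful. Letters and their adjoints are both
assumed bounded, because no rule passes from an element to its adjoint. -/
theorem exists_bound (h0 : ∀ n, 0 ≤ RatCode.val (derive axs n).2)
    (hletter : ∀ l, ∃ r, Bounds axs (RatPoly.toFree.{u} (RatPoly.letter l)) r)
    (f : FreeStarAlg.{u} (Fin k)) : ∃ r, Bounds axs f r := by
  induction f using MonoidAlgebra.induction_linear with
  | zero => exact ⟨0, zero⟩
  | add f g hf hg =>
    obtain ⟨r, hr⟩ := hf
    obtain ⟨s, hs⟩ := hg
    exact ⟨_, hr.add hs⟩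
  | single w c =>
    have hw : ∃ r, Bounds axs (MonoidAlgebra.single w 1 : FreeStarAlg.{u} (Fin k)) r := by
      obtain ⟨w, rfl⟩ := StarWord.ofList_surjective w
      induction w with
      -- Any number above 1 would do: the scalar rule is available here for strict bounds on `‖1‖`.
      | nil => exact ⟨2, by
        have h := Bounds.algebraMap (axs := axs) (r := 2) 1 (by simp)
        rwa [map_one] at h⟩
      | cons l w ih =>
        obtain ⟨r, hr⟩ := ih
        obtain ⟨s, hs⟩ := hletter l
        refine ⟨s * r, ?_⟩
        convert hs.mul h0 hr using 1
        have hone : codedScalars.ofCode GaussCode.one = 1 := Subtype.ext GaussCode.val_one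
        rw [RatPoly.letter, RatPoly.toFree_cons, RatPoly.toFree_nil, add_zero, hone,
          MonoidAlgebra.single_mul_single, ← StarWord.ofList_append, one_mul]
        rfl
    obtain ⟨r, hr⟩ := hw
    refine ⟨(‖(c : ℂ)‖ + 1) * r, ?_⟩
    convert (Bounds.algebraMap c (lt_add_one ‖(c : ℂ)‖)).mul h0 hr using 1
    simp [MonoidAlgebra.single_mul_single]

end Bounds

end NormJudgment

/-! ### The least derivable bound as a C*-seminorm -/

namespace NormJudgment

variable {k : ℕ} {axs : List (NormJudgment k)}

/-- The least bound that can be derived for `f`. -/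
noncomputable def leastBound (axs : List (NormJudgment k)) (f : FreeStarAlg.{u} (Fin k)) : ℝ :=
  sInf {r | Bounds axs f r}

section leastBound

variable (h0 : ∀ n, 0 ≤ RatCode.val (derive axs n).2)
  (hletter : ∀ l, ∃ r, Bounds axs (RatPoly.toFree.{u} (RatPoly.letter l)) r)
  {f g : FreeStarAlg.{u} (Fin k)} {r : ℝ}

include h0

theorem Bounds.nonneg (h : Bounds axs f r) : 0 ≤ r := by
  obtain ⟨n, -, hn⟩ := h
  exact le_trans (by exact_mod_cast h0 n) hn

theorem leastBound_nonneg : 0 ≤ leastBound axs f :=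
  Real.sInf_nonneg fun _ h => Bounds.nonneg h0 h

theorem leastBound_le (h : Bounds axs f r) : leastBound axs f ≤ r :=
  csInf_le ⟨0, fun _ h => Bounds.nonneg h0 h⟩ h

theorem leastBound_zero : leastBound axs (0 : FreeStarAlg.{u} (Fin k)) = 0 :=
  le_antisymm (leastBound_le h0 Bounds.zero) (leastBound_nonneg h0)

theorem leastBound_algebraMap_le (c : codedScalars) :
    leastBound axs (algebraMap codedScalars (FreeStarAlg.{u} (Fin k)) c) ≤ ‖(c : ℂ)‖ :=
  le_of_forall_gt_imp_ge_of_dense fun _ hr => leastBound_le h0 (Bounds.algebraMap c hr)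

include hletter

theorem bounds_of_leastBound_lt (h : leastBound axs f < r) : Bounds axs f r := by
  obtain ⟨s, hs, hsr⟩ := exists_lt_of_csInf_lt (Bounds.exists_bound h0 hletter f) h
  exact Bounds.mono hs hsr.le

theorem leastBound_add_le : leastBound axs (f + g) ≤ leastBound axs f + leastBound axs g := by
  refine le_of_forall_pos_le_add fun ε hε => ?_
  have hf := bounds_of_leastBound_lt h0 hletter
    (lt_add_of_pos_right (leastBound axs f) (half_pos hε))
  have hg := bounds_of_leastBound_lt h0 hletter
    (lt_add_of_pos_right (leastBound axs g) (half_pos hε))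
  exact (leastBound_le h0 (hf.add hg)).trans (by linarith)

theorem leastBound_mul_le : leastBound axs (f * g) ≤ leastBound axs f * leastBound axs g := by
  have h (ε : ℝ) (hε : 0 < ε) :
      leastBound axs (f * g) ≤ (leastBound axs f + ε) * (leastBound axs g + ε) :=
    leastBound_le h0 ((bounds_of_leastBound_lt h0 hletter (lt_add_of_pos_right _ hε)).mul h0
      (bounds_of_leastBound_lt h0 hletter (lt_add_of_pos_right _ hε)))
  have ht : Tendsto (fun ε : ℝ => (leastBound axs f + ε) * (leastBound axs g + ε)) (𝓝[>] 0)
      (𝓝 ((leastBound axs f + 0) * (leastBound axs g + 0))) :=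
    (Continuous.tendsto (by fun_prop) 0).mono_left nhdsWithin_le_nhds
  rw [add_zero, add_zero] at ht
  exact ge_of_tendsto ht (eventually_mem_nhdsWithin.mono h)

/-- If the least bound `N` had `N(f* f) < s < N(f)²`, the C*-identity rule would derive for `f` a
bound `r` with `√s < r < N(f)`. -/
theorem leastBound_mul_self_le :
    leastBound axs f * leastBound axs f ≤ leastBound axs (MonoidAlgebra.starAddHom f * f) := by
  by_contra! hlt
  have hN := leastBound_nonneg h0 (f := f)
  obtain ⟨s, hs1, hs2⟩ := exists_between hlt
  have hs0 : 0 ≤ s := (leastBound_nonneg h0).trans hs1.le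
  rw [← sq] at hs2
  obtain ⟨r, hr1, hr2⟩ := exists_between ((Real.sqrt_lt_sqrt hs0 hs2).trans_eq (Real.sqrt_sq hN))
  have hr0 : 0 < r := (Real.sqrt_nonneg s).trans_lt hr1
  have hb := Bounds.of_starAddHom_mul_self (bounds_of_leastBound_lt h0 hletter hs1) hr0
    ((Real.sqrt_lt' hr0).1 hr1)
  exact absurd (leastBound_le h0 hb) (not_le.2 hr2)

/-- The adjoint has no rule of its own. With `N` the least bound, `N(f*)² ≤ N(f f*) ≤ N(f) N(f*)`,
and one factor cancels unless it is zero. -/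
theorem leastBound_starAddHom_le :
    leastBound axs (MonoidAlgebra.starAddHom f) ≤ leastBound axs f := by
  let _ : StarRing (FreeStarAlg.{u} (Fin k)) := MonoidAlgebra.starRing
  have hss : MonoidAlgebra.starAddHom (MonoidAlgebra.starAddHom f) = f := star_star f
  have h1 := leastBound_mul_self_le h0 hletter (f := MonoidAlgebra.starAddHom f)
  rw [hss] at h1
  have h2 := h1.trans (leastBound_mul_le h0 hletter)
  rcases (leastBound_nonneg h0 (f := MonoidAlgebra.starAddHom f)).eq_or_lt with h | h
  · rw [← h]
    exact leastBound_nonneg h0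
  · exact le_of_mul_le_mul_right h2 h

/-- The free *-algebra maps to a C*-algebra in which the norm is the least derivable bound. -/
theorem exists_cstarAlgebra_norm_eq_leastBound :
    ∃ (D : Type u) (_ : CStarAlgebra D) (z : Fin k → D),
      ∀ p : RatPoly (Fin k), ‖p.eval z‖ = leastBound axs (RatPoly.toFree.{u} p) := by
  let _ : StarRing (FreeStarAlg.{u} (Fin k)) := MonoidAlgebra.starRing
  let N : RingSeminorm (FreeStarAlg.{u} (Fin k)) :=
    { toFun := leastBound axs
      map_zero' := leastBound_zero h0
      add_le' := fun f g => leastBound_add_le h0 hletter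
      -- Negation is multiplication by the scalar `-1`, whose least bound is at most 1.
      neg' := by
        have h (f : FreeStarAlg.{u} (Fin k)) : leastBound axs (-f) ≤ leastBound axs f := by
          have h1 := leastBound_mul_le h0 hletter
            (f := algebraMap codedScalars (FreeStarAlg.{u} (Fin k)) (-1)) (g := f)
          have h2 := leastBound_algebraMap_le.{u} h0 (-1)
          rw [map_neg, map_one,
            show (-1 : FreeStarAlg.{u} (Fin k)) * f = -f from neg_one_mul f] at h1
          simp only [map_neg, map_one, NegMemClass.coe_neg, OneMemClass.coe_one, norm_neg,
            norm_one] at h2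
          exact h1.trans (mul_le_of_le_one_left (leastBound_nonneg h0) h2)
        intro f
        exact le_antisymm (h f) (by simpa using h (-f))
      mul_le' := fun f g => leastBound_mul_le h0 hletter }
  let _ : SeminormedRing (FreeStarAlg.{u} (Fin k)) := N.toSeminormedRing
  have hKs (c : codedScalars) :
      MonoidAlgebra.starAddHom (algebraMap codedScalars (FreeStarAlg.{u} (Fin k)) c) =
        algebraMap codedScalars (FreeStarAlg.{u} (Fin k)) (star c) := by
    change MonoidAlgebra.starAddHom (MonoidAlgebra.single 1 c) = MonoidAlgebra.single 1 (star c)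
    rw [MonoidAlgebra.starAddHom_single, star_one]
  obtain ⟨D, _, ψ, hψc, hψs, hψn⟩ := exists_cstarAlgebra_of_seminormedRing
    (FreeStarAlg.{u} (Fin k)) (leastBound_algebraMap_le h0) hKs
    (fun f => leastBound_starAddHom_le h0 hletter) fun f => leastBound_mul_self_le h0 hletter
  let z : Fin k → D := fun j => ψ (MonoidAlgebra.single (StarWord.ofList [(j, false)]) 1)
  have hz (l : Fin k × Bool) :
      evalLetter z l = ψ (MonoidAlgebra.single (StarWord.ofList [l]) 1) := by
    rcases l with ⟨j, _ | _⟩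
    · rfl
    · simp only [evalLetter, if_true, z]
      rw [← hψs]
      congr 1
      change MonoidAlgebra.starAddHom _ = _
      rw [MonoidAlgebra.starAddHom_single, star_one, StarWord.star_ofList]
      rfl
  have hw (w : List (Fin k × Bool)) :
      (w.map (evalLetter z)).prod = ψ (MonoidAlgebra.single (StarWord.ofList w) 1) := by
    induction w with
    | nil =>
      rw [StarWord.ofList_nil, ← MonoidAlgebra.one_def, map_one]
      rfl
    | cons l w ih =>
      rw [List.map_cons, List.prod_cons, ih, hz, ← map_mul, MonoidAlgebra.single_mul_single,
        ← StarWord.ofList_append, one_mul]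
      rfl
  refine ⟨D, inferInstance, z, fun p => ?_⟩
  have hp : p.eval z = ψ (RatPoly.toFree p) := by
    induction p with
    | nil => rw [RatPoly.eval_nil, RatPoly.toFree_nil, map_zero]
    | cons t p ih =>
      rw [RatPoly.eval_cons, RatPoly.toFree_cons, map_add, ih, hw, Algebra.smul_def,
        ← codedScalars.coe_ofCode, ← hψc, ← map_mul]
      congr 2
      change MonoidAlgebra.single 1 _ * _ = _
      rw [MonoidAlgebra.single_mul_single, one_mul, mul_one]
      rfl
  rw [hp, hψn]
  rfl

end leastBound

/-- Every strict upper bound of a norm in the universal C*-algebra can be derived. -/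
theorem exists_derive_lt {R : FiniteRationalRelations k} {A : Type u} [CStarAlgebra A]
    [Nontrivial A] {x : Fin k → A} (hx : R.IsUniversal A x) (p : RatPoly (Fin k)) {r : ℝ}
    (hr : ‖p.eval x‖ < r) :
    ∃ n, RatPoly.FormalEq p (derive R.judgments n).1 ∧
      ((RatCode.val (derive R.judgments n).2 : ℚ) : ℝ) ≤ r := by
  have hrep := (R.isRepresentation_iff x).1 hx.1
  -- By soundness in `A`, each derived bound dominates a norm.
  have h0 (n : ℕ) : 0 ≤ RatCode.val (derive R.judgments n).2 := by
    have := (norm_nonneg _).trans (norm_eval_derive_le R.judgments x hrep n)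
    exact_mod_cast this
  -- The list of judgments bounds each `x j` and its adjoint by `C j`.
  have hletter (l : Fin k × Bool) :
      ∃ r, Bounds R.judgments (RatPoly.toFree.{u} (RatPoly.letter l)) r := by
    refine ⟨_, Bounds.of_mem (x := (RatPoly.letter l, (R.bound l.1).toRat)) ?_⟩
    refine List.mem_append_right _ (List.mem_flatMap.2 ⟨l.1, List.mem_finRange _, ?_⟩)
    rcases l with ⟨j, _ | _⟩ <;> simp
  -- Words are lifted to the universe of `A`, so that `D` is a legitimate target for the universal
  -- property.
  obtain ⟨D, _, z, hz⟩ := exists_cstarAlgebra_norm_eq_leastBound.{u} h0 hletter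
  obtain ⟨φ, hφ, -⟩ := hx.2 D z ((R.isRepresentation_iff z).2 fun y hy => by
    rw [hz]
    exact leastBound_le h0 (Bounds.of_mem hy))
  -- *-homomorphisms are contractive, so the least derivable bound of `p` is at most its norm in
  -- `A`.
  have hle : ‖p.eval z‖ ≤ ‖p.eval x‖ := by
    rw [← (funext hφ : (fun j => φ (x j)) = z), ← RatPoly.eval_map]
    exact NonUnitalStarAlgHom.norm_apply_le φ _
  rw [hz] at hle
  obtain ⟨n, hn1, hn2⟩ := bounds_of_leastBound_lt h0 hletter (hle.trans_lt hr)
  exact ⟨n, (RatPoly.formalEq_iff_toFree.{u} _ _).2 hn1.symm, hn2⟩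

end NormJudgment

/-! ### Density of rational points -/

namespace CStarPresentation

/-- The rational points of a presentation are dense. -/
theorem denseRange_eval {ι : Type} {A : Type u} [CStarAlgebra A] (P : CStarPresentation ι A) :
    DenseRange fun p : RatPoly ι => p.eval P.point := by
  set S : Set A := Set.range fun p : RatPoly ι => p.eval P.point with hS
  have hscalar (c : ℂ) : algebraMap ℂ A c ∈ closure S := by
    refine map_mem_closure (continuous_algebraMap ℂ A) (GaussCode.denseRange_val c) ?_
    rintro _ ⟨x, rfl⟩
    exact ⟨[(x, [])], by simp [RatPoly.eval, Algebra.algebraMap_eq_smul_one]⟩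
  have hadjoin : ∀ a ∈ StarAlgebra.adjoin ℂ (Set.range P.point), a ∈ closure S := by
    intro a ha
    induction ha using StarAlgebra.adjoin_induction with
    | mem x hx =>
      obtain ⟨j, rfl⟩ := hx
      exact subset_closure ⟨RatPoly.letter (j, false), by simp [RatPoly.eval_letter, evalLetter]⟩
    | algebraMap c => exact hscalar c
    | add x y _ _ hx hy =>
      refine map_mem_closure₂ continuous_add hx hy ?_
      rintro _ ⟨p, rfl⟩ _ ⟨q, rfl⟩
      exact ⟨p ++ q, RatPoly.eval_append _ p q⟩
    | mul x y _ _ hx hy =>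
      refine map_mem_closure₂ continuous_mul hx hy ?_
      rintro _ ⟨p, rfl⟩ _ ⟨q, rfl⟩
      exact ⟨RatPoly.mul p q, RatPoly.eval_mul _ p q⟩
    | star x _ hx =>
      refine map_mem_closure continuous_star hx ?_
      rintro _ ⟨p, rfl⟩
      exact ⟨RatPoly.adj p, RatPoly.eval_adj _ p⟩
  intro a
  have ha : a ∈ (StarAlgebra.adjoin ℂ (Set.range P.point)).topologicalClosure := by
    rw [P.generates]
    trivial
  have ha' : a ∈ closure (StarAlgebra.adjoin ℂ (Set.range P.point) : Set A) := ha
  exact closure_minimal hadjoin isClosed_closure ha'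

end CStarPresentation

/-! ### Approximate representations in a locally universal algebra -/

/-- Polynomials in the ultrapower are computed termwise. Since `BoundedSeq` carries only a seminorm,
`eval` does not apply to it, and the representing sequence is built from letters and words. -/
theorem CStarUltrapower.exists_lift_eval {ι : Type} {U : Ultrafilter ℕ} {B : Type u}
    [CStarAlgebra B] (f : ι → BoundedSeq U B) (p : RatPoly ι) :
    ∃ F : BoundedSeq U B,
      (SeparationQuotient.mk F : CStarUltrapower U B) =
        p.eval (fun j => (SeparationQuotient.mk (f j) : CStarUltrapower U B)) ∧
      ∀ m, F.term m = p.eval fun j => (f j).term m := by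
  have hletter (l : ι × Bool) : ∃ F : BoundedSeq U B,
      (SeparationQuotient.mk F : CStarUltrapower U B) =
        evalLetter (fun j => (SeparationQuotient.mk (f j) : CStarUltrapower U B)) l ∧
      ∀ m, F.term m = evalLetter (fun j => (f j).term m) l := by
    rcases l with ⟨j, _ | _⟩
    · exact ⟨f j, rfl, fun _ => rfl⟩
    · exact ⟨star (f j), rfl, fun _ => rfl⟩
  have hword (w : List (ι × Bool)) : ∃ F : BoundedSeq U B,
      (SeparationQuotient.mk F : CStarUltrapower U B) =
        (w.map (evalLetter fun j =>
          (SeparationQuotient.mk (f j) : CStarUltrapower U B))).prod ∧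
      ∀ m, F.term m = (w.map (evalLetter fun j => (f j).term m)).prod := by
    induction w with
    | nil => exact ⟨1, rfl, fun _ => rfl⟩
    | cons l w ih =>
      obtain ⟨F, hF, hFm⟩ := ih
      obtain ⟨G, hG, hGm⟩ := hletter l
      refine ⟨G * F, ?_, fun m => ?_⟩
      · rw [List.map_cons, List.prod_cons, ← hF, ← hG]
        rfl
      · rw [List.map_cons, List.prod_cons, ← hFm, ← hGm]
        rfl
  induction p with
  | nil => exact ⟨0, rfl, fun _ => rfl⟩
  | cons t p ih =>
    obtain ⟨F, hF, hFm⟩ := ih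
    obtain ⟨G, hG, hGm⟩ := hword t.2
    refine ⟨GaussCode.val t.1 • G + F, ?_, fun m => ?_⟩
    · rw [RatPoly.eval_cons, ← hF, ← hG]
      rfl
    · rw [RatPoly.eval_cons, ← hFm, ← hGm]
      rfl

theorem CStarUltrapower.tendsto_norm_eval {ι : Type} {U : Ultrafilter ℕ} {B : Type u}
    [CStarAlgebra B] (f : ι → BoundedSeq U B) (p : RatPoly ι) :
    Tendsto (fun m => ‖p.eval fun j => (f j).term m‖) U
      (𝓝 ‖p.eval fun j => (SeparationQuotient.mk (f j) : CStarUltrapower U B)‖) := by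
  obtain ⟨F, hF, hFm⟩ := exists_lift_eval f p
  rw [← hF]
  simp only [← hFm]
  exact F.tendsto_limNorm

/-- Tuples in a separable algebra are approximated by rational tuples in a locally universal
algebra. -/
theorem IsLocallyUniversal.exists_rational_tuple {B : Type u} [CStarAlgebra B]
    (hB : IsLocallyUniversal B) (Q : CStarPresentation ℕ B) {k : ℕ} {A : Type u} [CStarAlgebra A]
    [Nontrivial A] [TopologicalSpace.SeparableSpace A] (x : Fin k → A)
    (L : List (RatPoly (Fin k))) {δ : ℝ} (hδ : 0 < δ) :
    ∃ q : Fin k → RatPoly ℕ, ∀ p ∈ L,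
      |‖p.eval fun j => (q j).eval Q.point‖ - ‖p.eval x‖| < δ := by
  obtain ⟨U, -, φ, hφ⟩ := hB A
  choose f hf using fun j => SeparationQuotient.surjective_mk (φ (x j))
  have hlim (p : RatPoly (Fin k)) :
      Tendsto (fun m => ‖p.eval fun j => (f j).term m‖) U (𝓝 ‖p.eval x‖) := by
    have h := CStarUltrapower.tendsto_norm_eval f p
    rwa [show (fun j => (SeparationQuotient.mk (f j) : CStarUltrapower U B)) = fun j => φ (x j)
      from funext hf, ← RatPoly.eval_map, NonUnitalStarAlgHom.norm_map φ hφ] at h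
  -- The embedding is isometric, so each norm in `A` is a limit along `U`; for finitely many
  -- polynomials one index serves all of them.
  have hev : ∀ᶠ m in (U : Filter ℕ), ∀ p ∈ L,
      |‖p.eval fun j => (f j).term m‖ - ‖p.eval x‖| < δ :=
    (eventually_all_finite L.finite_toSet).2 fun p _ =>
      (Metric.tendsto_nhds.1 (hlim p) δ hδ).mono fun m hm => by rwa [Real.dist_eq] at hm
  obtain ⟨m, hm⟩ := hev.exists
  -- The approximation is an open condition on the tuple, so the tuple found in `B` can be replaced
  -- by rational points.
  have hopen : IsOpen {z : Fin k → B | ∀ p ∈ L, |‖p.eval z‖ - ‖p.eval x‖| < δ} := by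
    have : {z : Fin k → B | ∀ p ∈ L, |‖p.eval z‖ - ‖p.eval x‖| < δ} =
        ⋂ p ∈ {p | p ∈ L}, {z : Fin k → B | |‖p.eval z‖ - ‖p.eval x‖| < δ} := by
      ext; simp
    rw [this]
    exact L.finite_toSet.isOpen_biInter fun p _ => isOpen_lt
      ((RatPoly.continuous_eval p).norm.sub continuous_const).abs continuous_const
  have hdense : DenseRange fun (q : Fin k → RatPoly ℕ) (j : Fin k) => (q j).eval Q.point :=
    DenseRange.piMap fun _ => Q.denseRange_eval
  obtain ⟨q, hq⟩ := hdense.exists_mem_open hopen ⟨_, hm⟩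
  exact ⟨q, hq⟩

/-! ### A modulus of continuity -/

namespace RatPoly

variable {ι : Type}

/-- A Lipschitz constant and a bound for a word on tuples of norm at most `M`. -/
def wordLip (M : ℕ) (w : List (ι × Bool)) : ℕ × ℕ :=
  w.foldr (fun _ acc => (M * acc.1 + acc.2, M * acc.2)) (0, 1)

/-- A Lipschitz constant for a polynomial on tuples of norm at most `M`. -/
def lip (M : ℕ) (p : RatPoly ι) : ℕ :=
  p.foldr (fun t acc => GaussCode.absBound t.1 * (wordLip M t.2).1 + acc) 0

open Primrec in
theorem primrec_lip [Primcodable ι] (M : ℕ) : Primrec (lip (ι := ι) M) := by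
  have hw : Primrec (wordLip (ι := ι) M) := by
    refine list_foldr (α := List (ι × Bool)) (h := fun _ y => (M * y.2.1 + y.2.2, M * y.2.2))
      Primrec.id (Primrec.const (0, 1)) ?_
    have h1 : Primrec fun a : List (ι × Bool) × (ι × Bool) × ℕ × ℕ => a.2.2.1 :=
      fst.comp (snd.comp snd)
    have h2 : Primrec fun a : List (ι × Bool) × (ι × Bool) × ℕ × ℕ => a.2.2.2 :=
      snd.comp (snd.comp snd)
    exact (Primrec.pair (nat_add.comp (nat_mul.comp (Primrec.const M) h1) h2)
      (nat_mul.comp (Primrec.const M) h2)).to₂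
  refine list_foldr (α := RatPoly ι)
    (h := fun _ y => GaussCode.absBound y.1.1 * (wordLip M y.1.2).1 + y.2)
    Primrec.id (Primrec.const 0) ?_
  exact (nat_add.comp (nat_mul.comp (GaussCode.primrec_absBound.comp (fst.comp (fst.comp snd)))
    (fst.comp (hw.comp (snd.comp (fst.comp snd))))) (snd.comp snd)).to₂

variable {C : Type v} [CStarAlgebra C] {y z : ι → C} {M : ℕ} {ε : ℝ}

/-- Product rule: `yY - zZ = y(Y - Z) + (y - z)Z`. The bound on the word is carried along for the
second summand. -/
theorem norm_sub_prod_le [Nontrivial C] (hy : ∀ j, ‖y j‖ ≤ M) (hz : ∀ j, ‖z j‖ ≤ M)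
    (hyz : ∀ j, ‖y j - z j‖ ≤ ε) (w : List (ι × Bool)) :
    ‖(w.map (evalLetter y)).prod - (w.map (evalLetter z)).prod‖ ≤ (wordLip M w).1 * ε ∧
      ‖(w.map (evalLetter z)).prod‖ ≤ (wordLip M w).2 := by
  have hyl (l : ι × Bool) : ‖evalLetter y l‖ ≤ M := by
    rcases l with ⟨j, _ | _⟩ <;> simpa [evalLetter] using hy j
  have hzl (l : ι × Bool) : ‖evalLetter z l‖ ≤ M := by
    rcases l with ⟨j, _ | _⟩ <;> simpa [evalLetter] using hz j
  have hyzl (l : ι × Bool) : ‖evalLetter y l - evalLetter z l‖ ≤ ε := by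
    rcases l with ⟨j, _ | _⟩
    · simpa [evalLetter] using hyz j
    · simpa [evalLetter, ← star_sub] using hyz j
  induction w with
  | nil => simp [wordLip]
  | cons l w ih =>
    obtain ⟨ih1, ih2⟩ := ih
    simp only [List.map_cons, List.prod_cons]
    set Y := (w.map (evalLetter y)).prod
    set Z := (w.map (evalLetter z)).prod
    have hl : wordLip M (l :: w) = (M * (wordLip M w).1 + (wordLip M w).2, M * (wordLip M w).2) :=
      rfl
    rw [hl]
    push_cast
    constructor
    · have h : evalLetter y l * Y - evalLetter z l * Z =
          evalLetter y l * (Y - Z) + (evalLetter y l - evalLetter z l) * Z := by noncomm_ring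
      have h1 : ‖evalLetter y l * (Y - Z)‖ ≤ M * ((wordLip M w).1 * ε) :=
        (norm_mul_le _ _).trans
          (mul_le_mul (hyl l) ih1 (norm_nonneg _) (Nat.cast_nonneg M))
      have h2 : ‖(evalLetter y l - evalLetter z l) * Z‖ ≤ ε * (wordLip M w).2 :=
        (norm_mul_le _ _).trans
          (mul_le_mul (hyzl l) ih2 (norm_nonneg _) ((norm_nonneg _).trans (hyzl l)))
      rw [h]
      exact (norm_add_le _ _).trans (by linarith)
    · exact (norm_mul_le _ _).trans (mul_le_mul (hzl l) ih2 (norm_nonneg _) (Nat.cast_nonneg M))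

theorem norm_eval_sub_le [Nontrivial C] (hy : ∀ j, ‖y j‖ ≤ M) (hz : ∀ j, ‖z j‖ ≤ M)
    (hyz : ∀ j, ‖y j - z j‖ ≤ ε) (p : RatPoly ι) :
    ‖eval p y - eval p z‖ ≤ lip M p * ε := by
  induction p with
  | nil => simp [eval_nil, lip]
  | cons t p ih =>
    have hl : lip M (t :: p) = GaussCode.absBound t.1 * (wordLip M t.2).1 + lip M p := rfl
    rw [eval_cons, eval_cons, add_sub_add_comm, ← smul_sub, hl]
    push_cast
    rw [add_mul, mul_assoc]
    refine (norm_add_le _ _).trans (add_le_add ?_ ih)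
    rw [norm_smul]
    exact mul_le_mul (GaussCode.norm_val_le _) (norm_sub_prod_le hy hz hyz _).1 (norm_nonneg _)
      (Nat.cast_nonneg _)

end RatPoly

/-! ### Unbounded search -/

/-- Run through all codes of candidates until the test succeeds; the search terminates because a
witness exists for every input. -/
theorem exists_computable_search {α β : Type*} [Primcodable α] [Primcodable β] {c : α → β → Bool}
    (hc : Computable₂ c) (h : ∀ a, ∃ b, c a b = true) :
    ∃ g : α → β, Computable g ∧ ∀ a, c a (g a) = true := by
  let s : α → ℕ → Option β := fun a n =>
    (Encodable.decode (α := β) n).bind fun b => bif c a b then some b else none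
  have hs : Computable₂ s := by
    refine Computable.option_bind (Computable.decode.comp Computable.snd) ?_
    exact (Computable.cond (hc.comp (Computable.fst.comp Computable.fst) Computable.snd)
      (Computable.option_some.comp Computable.snd) (Computable.const none)).to₂
  have hdom (a : α) : (Nat.rfindOpt (s a)).Dom := by
    obtain ⟨b, hb⟩ := h a
    exact Nat.rfindOpt_dom.2 ⟨Encodable.encode b, b, by simp [s, hb]⟩
  refine ⟨fun a => (Nat.rfindOpt (s a)).get (hdom a),
    (Partrec.rfindOpt hs).of_eq fun a => (Part.some_get (hdom a)).symm, fun a => ?_⟩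
  obtain ⟨n, hn⟩ := Nat.rfindOpt_spec (Part.get_mem (hdom a))
  obtain ⟨b, -, hb⟩ := Option.bind_eq_some_iff.1 hn
  cases hcb : c a b with
  | false => simp [hcb] at hb
  | true =>
    rw [hcb, cond_true, Option.some.injEq] at hb
    exact (congrArg (c a) hb).symm.trans hcb

theorem Computable.list_all {α β : Type*} [Primcodable α] {c : α → β → Bool} (L : List β)
    (hc : ∀ b ∈ L, Computable fun a => c a b) : Computable fun a => L.all (c a) := by
  induction L with
  | nil => exact Computable.const true
  | cons b L ih =>
    simp only [List.all_cons]
    exact Primrec.and.to_comp.comp (hc b (by simp)) (ih fun b' hb' => hc b' (by simp [hb']))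

/-! ### Certificates -/

section search

open NormJudgment

variable {k : ℕ} (R : FiniteRationalRelations k) (M : ℕ) (f : RatPoly ℕ → ℕ → RatCode)
  (m : ℕ → ℕ)

/-- The precision to which representations have to be approximated. -/
def searchPrecision (a : RatPoly (Fin k) × ℕ) : ℕ := m (RatPoly.lip M a.1 + (a.2 + 2))

/-- The candidate `(i, q)` certifies that the bound in the `i`-th derivable judgment is close to
the norm of the polynomial. -/
def isCertificate (a : RatPoly (Fin k) × ℕ) (c : ℕ × (Fin k → RatPoly ℕ)) : Bool :=
  decide (RatPoly.FormalEq a.1 (derive R.judgments c.1).1) &&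
    (decide (RatCode.LE (derive R.judgments c.1).2
      (RatCode.add (f (RatPoly.subst c.2 a.1) (a.2 + 3)) (RatCode.half (a.2 + 1)))) &&
    R.judgments.all fun y => decide (RatCode.LE
      (RatCode.add (f (RatPoly.subst c.2 y.1) (searchPrecision M m a + 2))
        (RatCode.half (searchPrecision M m a + 2)))
      (RatCode.add y.2 (RatCode.half (searchPrecision M m a)))))

variable {f m}

/-- Beyond the algorithms `f` for `B` and `m` for stability, every ingredient is primitive
recursive; `R` and `M` are fixed constants. -/
theorem computable_isCertificate (hf : Computable₂ f) (hm : Computable m) :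
    Computable₂ (isCertificate R M f m) := by
  let α := (RatPoly (Fin k) × ℕ) × ℕ × (Fin k → RatPoly ℕ)
  have hp : Primrec fun x : α => x.1.1 := Primrec.fst.comp Primrec.fst
  have hN : Primrec fun x : α => x.1.2 := Primrec.snd.comp Primrec.fst
  have hd : Primrec fun x : α => derive R.judgments x.2.1 :=
    (primrec_derive _).comp (Primrec.fst.comp Primrec.snd)
  have hq : Primrec fun x : α => x.2.2 := Primrec.snd.comp Primrec.snd
  have hadd (j : ℕ) {g : α → ℕ} (hg : Computable g) : Computable fun x => g x + j :=
    Primrec.nat_add.to_comp.comp hg (Computable.const j)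
  have hhalf {g : α → ℕ} (hg : Computable g) : Computable fun x => RatCode.half (g x) :=
    RatCode.primrec_half.to_comp.comp hg
  have hle {g h : α → RatCode} (hg : Computable g) (hh : Computable h) :
      Computable fun x => decide (RatCode.LE (g x) (h x)) :=
    RatCode.primrec_LE.decide.to_comp.comp hg hh
  have hsum {g h : α → RatCode} (hg : Computable g) (hh : Computable h) :
      Computable fun x => RatCode.add (g x) (h x) :=
    RatCode.primrec_add.to_comp.comp hg hh
  have hS : Computable fun x : α => searchPrecision M m x.1 :=
    hm.comp (Primrec.nat_add.to_comp.comp ((RatPoly.primrec_lip M).comp hp).to_comp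
      (hadd 2 hN.to_comp))
  refine Primrec.and.to_comp.comp
    (RatPoly.primrec_formalEq.decide.to_comp.comp hp.to_comp (Primrec.fst.comp hd).to_comp)
    (Primrec.and.to_comp.comp ?_ (Computable.list_all _ fun y _ => ?_))
  · exact hle (Primrec.snd.comp hd).to_comp (hsum
      (hf.comp (RatPoly.primrec_subst.comp hq hp).to_comp (hadd 3 hN.to_comp))
      (hhalf (hadd 1 hN.to_comp)))
  · exact hle (hsum
      (hf.comp (RatPoly.primrec_subst.comp hq (Primrec.const y.1)).to_comp (hadd 2 hS))
      (hhalf (hadd 2 hS))) (hsum (Computable.const y.2) (hhalf hS))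

theorem isCertificate_eq_true_iff (a : RatPoly (Fin k) × ℕ) (c : ℕ × (Fin k → RatPoly ℕ)) :
    isCertificate R M f m a c = true ↔
      RatPoly.FormalEq a.1 (derive R.judgments c.1).1 ∧
      ((RatCode.val (derive R.judgments c.1).2 : ℚ) : ℝ) ≤
        ((RatCode.val (f (RatPoly.subst c.2 a.1) (a.2 + 3)) : ℚ) : ℝ) + (2 : ℝ)⁻¹ ^ (a.2 + 1) ∧
      ∀ y ∈ R.judgments,
        ((RatCode.val (f (RatPoly.subst c.2 y.1) (searchPrecision M m a + 2)) : ℚ) : ℝ) +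
          (2 : ℝ)⁻¹ ^ (searchPrecision M m a + 2) ≤
        ((RatCode.val y.2 : ℚ) : ℝ) + (2 : ℝ)⁻¹ ^ searchPrecision M m a := by
  simp only [isCertificate, Bool.and_eq_true, decide_eq_true_eq, List.all_eq_true,
    RatCode.LE_iff, ← Rat.cast_le (K := ℝ), RatCode.val_add, RatCode.val_half, Rat.cast_add,
    Rat.cast_pow, Rat.cast_inv, Rat.cast_ofNat]

end search

/-! ### Correctness and existence of certificates -/

namespace CStarPresentation

open NormJudgment

variable {k : ℕ} {R : FiniteRationalRelations k} {A : Type u} [CStarAlgebra A]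
  {P : CStarPresentation (Fin k) A} {B : Type u} [CStarAlgebra B]
  {Q : CStarPresentation ℕ B} {M : ℕ} {f : RatPoly ℕ → ℕ → RatCode} {m : ℕ → ℕ}

/-- Approximate representations give lower bounds for norms in a weakly stable algebra. -/
theorem norm_eval_le_of_satisfiesUpTo [Nontrivial B] (hP : P.IsStandard R)
    (hM : ∀ j, DyadicCode.val (R.bound j) + 1 ≤ M)
    (hm : ∀ (n : ℕ) (C : Type u) [CStarAlgebra C] (z : Fin k → C),
      R.SatisfiesUpTo z ((2 : ℝ)⁻¹ ^ m n) →
        ∃ φ : A →⋆ₐ[ℂ] C, ∀ j, ‖φ (P.point j) - z j‖ < (2 : ℝ)⁻¹ ^ n)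
    (p : RatPoly (Fin k)) (n : ℕ) (z : Fin k → B)
    (hz : R.SatisfiesUpTo z ((2 : ℝ)⁻¹ ^ m (RatPoly.lip M p + n))) :
    ‖p.eval z‖ ≤ ‖p.eval P.point‖ + (2 : ℝ)⁻¹ ^ n := by
  obtain ⟨φ, hφ⟩ := hm _ B z hz
  -- The tolerance is at most 1, which the summand 1 in `hM` absorbs.
  have hzM (j : Fin k) : ‖z j‖ ≤ M :=
    (hz.2 j).trans ((add_le_add_right (pow_le_one₀ (by norm_num) (by norm_num)) _).trans (hM j))
  have hxM (j : Fin k) : ‖φ (P.point j)‖ ≤ M :=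
    (NonUnitalStarAlgHom.norm_apply_le φ _).trans ((hP.1.2 j).trans (by linarith [hM j]))
  have h1 := RatPoly.norm_eval_sub_le hzM hxM
    (fun j => by rw [norm_sub_rev]; exact (hφ j).le) p
  have h2 : ‖p.eval fun j => φ (P.point j)‖ ≤ ‖p.eval P.point‖ := by
    rw [← RatPoly.eval_map]
    exact NonUnitalStarAlgHom.norm_apply_le φ _
  -- With `L` the Lipschitz constant, precision `2 ^ (-(L + n))` suffices because `L ≤ 2 ^ L`.
  have h3 : (RatPoly.lip M p : ℝ) * (2 : ℝ)⁻¹ ^ (RatPoly.lip M p + n) ≤ (2 : ℝ)⁻¹ ^ n := by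
    rw [pow_add, ← mul_assoc]
    refine mul_le_of_le_one_left (by positivity) ?_
    rw [inv_pow, ← div_eq_mul_inv, div_le_one (by positivity)]
    exact_mod_cast Nat.lt_two_pow_self.le
  have h4 := norm_sub_norm_le (p.eval z) (p.eval fun j => φ (P.point j))
  linarith

/-- The derived bound is at least `‖p(x)‖` by soundness. It exceeds it by less than `(1/2 + 1/8 +
1/4) 2⁻ᴺ`: the gap allowed by the certificate, the error of `f`, and the loss from weak stability.
-/
theorem abs_sub_lt_of_isCertificate [Nontrivial A] [Nontrivial B] (hP : P.IsStandard R)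
    (hM : ∀ j, DyadicCode.val (R.bound j) + 1 ≤ M)
    (hf : ∀ (p : RatPoly ℕ) (n : ℕ),
      |‖p.eval Q.point‖ - ((RatCode.val (f p n) : ℚ) : ℝ)| < (2 : ℝ)⁻¹ ^ n)
    (hm : ∀ (n : ℕ) (C : Type u) [CStarAlgebra C] (z : Fin k → C),
      R.SatisfiesUpTo z ((2 : ℝ)⁻¹ ^ m n) →
        ∃ φ : A →⋆ₐ[ℂ] C, ∀ j, ‖φ (P.point j) - z j‖ < (2 : ℝ)⁻¹ ^ n)
    {p : RatPoly (Fin k)} {N : ℕ} {c : ℕ × (Fin k → RatPoly ℕ)}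
    (h : isCertificate R M f m (p, N) c = true) :
    |‖p.eval P.point‖ - ((RatCode.val (derive R.judgments c.1).2 : ℚ) : ℝ)| < (2 : ℝ)⁻¹ ^ N := by
  obtain ⟨h1, h2, h3⟩ := (isCertificate_eq_true_iff R M _ _).1 h
  have hz : R.SatisfiesUpTo (fun j => (c.2 j).eval Q.point)
      ((2 : ℝ)⁻¹ ^ m (RatPoly.lip M p + (N + 2))) := by
    rw [R.satisfiesUpTo_iff]
    intro y hy
    have h4 := (abs_lt.1 (hf (RatPoly.subst c.2 y.1) (searchPrecision M m (p, N) + 2))).2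
    rw [RatPoly.eval_subst] at h4
    exact (sub_lt_iff_lt_add'.1 h4).le.trans (h3 y hy)
  have h5 := norm_eval_le_of_satisfiesUpTo hP hM hm p (N + 2) _ hz
  have h6 := (abs_lt.1 (hf (RatPoly.subst c.2 p) (N + 3))).1
  rw [RatPoly.eval_subst] at h6
  have h7 := norm_eval_derive_le R.judgments P.point
    ((R.isRepresentation_iff P.point).1 hP.1) c.1
  rw [← h1.eval_eq] at h7
  have hpos : (0 : ℝ) < (2 : ℝ)⁻¹ ^ N := by positivity
  simp only [pow_add] at h2 h5 h6
  rw [abs_lt]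
  constructor <;> linarith

/-- Derivation, approximation in `B` and computation of the norm each cost at most `2⁻ᴺ / 8`, within
the allowed gap `2⁻ᴺ / 2`. For the relations, with `S` the search precision, approximation costs
`2⁻ˢ / 2`, the error of `f` costs `2⁻ˢ / 4`, and the safety margin in the test is another `2⁻ˢ / 4`,
which together make up the tolerance `2⁻ˢ`. -/
theorem exists_isCertificate [Nontrivial A] (hP : P.IsStandard R) (hB : IsLocallyUniversal B)
    (hf : ∀ (p : RatPoly ℕ) (n : ℕ),
      |‖p.eval Q.point‖ - ((RatCode.val (f p n) : ℚ) : ℝ)| < (2 : ℝ)⁻¹ ^ n)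
    (a : RatPoly (Fin k) × ℕ) : ∃ c, isCertificate R M f m a c = true := by
  obtain ⟨p, N⟩ := a
  have : TopologicalSpace.SeparableSpace A :=
    .of_denseRange _ P.denseRange_eval
  obtain ⟨i, hi1, hi2⟩ := exists_derive_lt hP p
    (lt_add_of_pos_right ‖p.eval P.point‖ (by positivity : (0 : ℝ) < (2 : ℝ)⁻¹ ^ (N + 3)))
  set S := searchPrecision M m (p, N) with hS
  obtain ⟨q, hq⟩ := hB.exists_rational_tuple Q P.point (p :: R.judgments.map Prod.fst)
    (δ := min ((2 : ℝ)⁻¹ ^ (N + 3)) ((2 : ℝ)⁻¹ ^ (S + 1))) (by positivity)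
  refine ⟨(i, q), (isCertificate_eq_true_iff R M _ _).2 ⟨hi1, ?_, fun y hy => ?_⟩⟩
  · have h1 := (abs_lt.1 ((hq p (by simp)).trans_le (min_le_left _ _))).1
    have h2 := (abs_lt.1 (hf (RatPoly.subst q p) (N + 3))).2
    rw [RatPoly.eval_subst] at h2
    have hpos : (0 : ℝ) < (2 : ℝ)⁻¹ ^ N := by positivity
    simp only [pow_add] at hi2 h1 h2 ⊢
    linarith
  · have h1 := (abs_lt.1 ((hq y.1
      (List.mem_cons_of_mem _ (List.mem_map_of_mem hy))).trans_le (min_le_right _ _))).2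
    have h2 := (abs_lt.1 (hf (RatPoly.subst q y.1) (S + 2))).1
    rw [RatPoly.eval_subst] at h2
    have h3 := (R.isRepresentation_iff P.point).1 hP.1 y hy
    rw [← hS]
    simp only [pow_add] at h1 h2 ⊢
    linarith

end CStarPresentation

/-! ### The theorem -/

theorem mainTheorem1
    (hB : ∃ (B : Type u) (_ : CStarAlgebra B) (Q : CStarPresentation ℕ B),
      IsLocallyUniversal B ∧ Q.IsComputable)
    (k : ℕ) (R : FiniteRationalRelations k) (A : Type u) [CStarAlgebra A]
    (P : CStarPresentation (Fin k) A) (hP : P.IsStandard R)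
    (hstable : P.IsComputablyWeaklyStable R) :
    P.IsComputable := by
  -- Local universality concerns only nonzero algebras; in the zero algebra all norms are 0.
  rcases subsingleton_or_nontrivial A with hA | hA
  · refine ⟨fun _ _ => RatCode.zero, Computable.const _, fun p n => ?_⟩
    rw [Subsingleton.elim (p.eval P.point) 0, RatCode.val_zero]
    simp
  obtain ⟨B, _, Q, hB, f, hfc, hf⟩ := hB
  obtain ⟨m, hmc, hm⟩ := hstable
  have : TopologicalSpace.SeparableSpace A :=
    .of_denseRange _ P.denseRange_eval
  -- An ultrapower of the zero algebra is zero and cannot contain `A`.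
  have : Nontrivial B := by
    by_contra hB'
    rw [not_nontrivial_iff_subsingleton] at hB'
    obtain ⟨U, -, φ, hφ⟩ := hB A
    refine one_ne_zero (hφ (?_ : φ (1 : A) = φ 0))
    rw [map_one, map_zero]
    exact congrArg SeparationQuotient.mk
      (BoundedContinuousFunction.ext fun m => Subsingleton.elim _ _)
  obtain ⟨M, hM⟩ : ∃ M : ℕ, ∀ j, DyadicCode.val (R.bound j) + 1 ≤ M := by
    choose b hb using fun j => exists_nat_ge (DyadicCode.val (R.bound j) + 1)
    refine ⟨∑ j, b j, fun j => (hb j).trans ?_⟩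
    exact_mod_cast Finset.single_le_sum (f := b) (fun _ _ => Nat.zero_le _) (Finset.mem_univ j)
  obtain ⟨g, hgc, hg⟩ := exists_computable_search
    (computable_isCertificate R M hfc hmc)
    (CStarPresentation.exists_isCertificate hP hB hf)
  -- The output is the upper bound from the derivation in the certificate; the tuple in `B` only
  -- certifies its accuracy.
  refine ⟨fun p N => (NormJudgment.derive R.judgments (g (p, N)).1).2, ?_, fun p N =>
    CStarPresentation.abs_sub_lt_of_isCertificate hP hM hf hm (hg (p, N))⟩
  exact Computable.snd.comp ((NormJudgment.primrec_derive _).to_comp.comp (Computable.fst.comp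
    (hgc.comp (Computable.fst.pair Computable.snd))))
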